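/- Let $d \ge 2$ and let $\Omega \subset \mathbb{R}^d$ be a compact convex set that is symmetric about the origin. *Definitions.* A field bandlimited to a set $K\subset\mathbb{R}^k$ is a (continuous) $f \in L^2(\mathbb{R}^k)$ whose Fourier transform $F(\omega)=\int f(r)e^{-i\langle\omega,r\rangle}\,dr$ vanishes (almost everywhere) outside $K$. A lattice $b=\{\sum_{i=1}^{k} m_i w_i : m\in\mathbb{Z}^{k}\}$, with $w_1,\dots,w_{k}$ a basis of $\mathbb{R}^{k}$, is a *sampling lattice* for $K$ if every field bandlimited to $K$ is uniquely determined by its values on $b$; its sampling density is its average number of points per unit volume. Write $\rho(K)$ for the infimum of the sampling densities of the sampling lattices for $K$. For a countable set $P$ of curves $p:\mathbb{R}\to\mathbb{R}^d$, let $\mathcal{D}^P(a,x)$ be the total arc length of the curves within the closed ball $B_a(x)$ of radius $a$ about $x$; the path density of $P$ is $\ell(P)=\limsup_{a\to\infty}\sup_x \mathcal{D}^P(a,x)/\mathrm{Vol}(B_a)$. $P$ is a *Nyquist trajectory set* for $\Omega$ if (i) there is a set $\Lambda$ of points on the curves of $P$, with distinct points at distance bounded below by a positive constant, such that every field bandlimited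 to $\Omega$ is uniquely determined by its values on $\Lambda$, and (ii) for each $x$ there is a continuous curve of length at most $\mathcal{D}^P(a,x)+o(a^d)$ containing the part of $P$ that lies in $B_a(x)$. A *uniform set* is a set of lines $P=\{p_m: m\in\mathbb{Z}^{d-1}\}$, $p_m(t)=\sum_{i=1}^{d-1}m_iv_i+t\,v_d$, where $v_1,\dots,v_d$ is a basis of $\mathbb{R}^d$ with $\langle v_i,v_d\rangle=\delta_{id}$ for all $i\le d$. Let $\mathcal{F}_\Omega$ be the collection of uniform sets that are Nyquist trajectory sets for $\Omega$. For a real $d\times d$ unitary (that is, orthogonal) matrix $U$ put $\hat\Omega^U=\{s\in\mathbb{R}^{d-1}: U^{-1}(s,0)\in\Omega\}$. For a basis $w=(w_1,\dots,w_{d-1})$ of $\mathbb{R}^{d-1}$ let $\hat P(U,w)$ be the uniform set with $v_i=U^{-1}(w_i,0)$ for $i\le d-1$ and $v_d=U^{-1}e^d$, where $e^d$ is the last standard unit vector. *Claim.* There is an optimal $\hat U$, i.e. one with $\rho(\hat\Omega^{\hat U})\le\rho(\hat\Omega^{V})$ for all orthogonal $V$. For every optimal $\hat U$: 1. If $w$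 generates a sampling lattice for $\hat\Omega^{\hat U}$ whose density equals $\rho(\hat\Omega^{\hat U})$, then $\hat P(\hat U,w)\in\mathcal{F}_\Omega$ and $\ell(\hat P(\hat U,w))\le\ell(Q)$ for all $Q\in\mathcal{F}_\Omega$. 2. There are families $(w^\epsilon)_{\epsilon>0}$ of bases generating sampling lattices for $\hat\Omega^{\hat U}$ whose densities tend to $\rho(\hat\Omega^{\hat U})$ as $\epsilon\to0$, and for every such family the uniform sets $\hat P^\epsilon=\hat P(\hat U,w^\epsilon)$ satisfy $\hat P^\epsilon\in\mathcal{F}_\Omega$ for all $\epsilon>0$ and $$\lim_{\epsilon\to0}\ell(\hat P^\epsilon)=\inf_{Q\in\mathcal{F}_\Omega}\ell(Q).$$ -/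

import Mathlib

open MeasureTheory Filter Topology FourierTransform
open scoped ENNReal

noncomputable section

namespace PathSampling

/-- `ℝ^d` with the Euclidean norm. -/
abbrev E (d : ℕ) : Type := EuclideanSpace ℝ (Fin d)

/-! ### Bandlimited fields and sets of uniqueness -/

/-- The fields bandlimited to `Ω`: the `f : ℝ^d → ℂ` of finite energy (represented by continuous
functions, so that point values make sense) whose Fourier transform
`F(ω) = ∫ f(r) exp(-i⟨ω, r⟩) dr` (in the `L²` sense) vanishes off `Ω`. Mathlib's transform is
`𝓕 f ξ = ∫ f(r) exp(-2πi⟨ξ, r⟩) dr = F(2πξ)`. -/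
def Bandlimited {d : ℕ} (Ω : Set (E d)) : Set (E d → ℂ) :=
  {f | Continuous f ∧ ∃ hf : MemLp f 2 (volume : Measure (E d)),
    ∀ᵐ ξ ∂(volume : Measure (E d)), (2 * Real.pi) • ξ ∉ Ω →
      (𝓕 (hf.toLp f) : Lp ℂ 2 (volume : Measure (E d))) ξ = 0}

/-- Every field bandlimited to `Ω` is uniquely determined by its values on `Λ`. -/
def Determines {d : ℕ} (Ω Λ : Set (E d)) : Prop :=
  ∀ f ∈ Bandlimited Ω, ∀ g ∈ Bandlimited Ω, (∀ x ∈ Λ, f x = g x) → f = g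

/-- `Λ` is uniformly discrete: distinct points are at distance greater than a fixed `r > 0`. -/
def UniformlyDiscrete {d : ℕ} (Λ : Set (E d)) : Prop :=
  ∃ r : ℝ, 0 < r ∧ ∀ x ∈ Λ, ∀ y ∈ Λ, x ≠ y → r < dist x y

/-! ### Trajectory sets, path density, Nyquist trajectory sets -/

/-- A trajectory set: a countable collection of curves `ℝ → ℝ^d`, here differentiable ones, so
that arc length is the integral of the speed. -/
def IsTrajectorySet {d : ℕ} (P : Set (ℝ → E d)) : Prop :=
  P.Countable ∧ ∀ p ∈ P, Differentiable ℝ p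

/-- `𝒟^P(a, x)`: the total arc length of the trajectories in `P` within the closed ball of
radius `a` about `x`. -/
def lengthInBall {d : ℕ} (P : Set (ℝ → E d)) (a : ℝ) (x : E d) : ℝ≥0∞ :=
  ∑' p : P, ∫⁻ t in {t : ℝ | ‖p.1 t - x‖ ≤ a}, ‖deriv p.1 t‖ₑ

/-- The path density `ℓ(P)`. -/
def pathDensity {d : ℕ} (P : Set (ℝ → E d)) : ℝ≥0∞ :=
  limsup (fun a : ℝ => (⨆ x : E d, lengthInBall P a x) /
    volume (Metric.closedBall (0 : E d) a)) atTop

/-- The Nyquist condition: some uniformly discrete set of points on the trajectories determines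
all fields bandlimited to `Ω`. -/
def NyquistCondition {d : ℕ} (Ω : Set (E d)) (P : Set (ℝ → E d)) : Prop :=
  ∃ Λ : Set (E d), UniformlyDiscrete Λ ∧ (∀ y ∈ Λ, ∃ p ∈ P, ∃ t : ℝ, p t = y) ∧ Determines Ω Λ

/-- Non-degeneracy: for every `x`, a continuous curve of length at most
`𝒟^P(a, x) + o(a^d)` contains the part of `P` that lies in the ball of radius `a` about `x`. -/
def NonDegenerate {d : ℕ} (P : Set (ℝ → E d)) : Prop :=
  ∀ x : E d, ∃ h : ℝ → ℝ, h =o[atTop] (fun a : ℝ => a ^ d) ∧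
    ∀ a : ℝ, 0 < a → ∃ c : ℝ → E d, ContinuousOn c (Set.Icc 0 1) ∧
      eVariationOn c (Set.Icc 0 1) ≤ lengthInBall P a x + ENNReal.ofReal (h a) ∧
      ∀ p ∈ P, ∀ t : ℝ, ‖p t - x‖ ≤ a → p t ∈ c '' Set.Icc 0 1

/-- The collection `𝒩_Ω` of Nyquist trajectory sets for `Ω`. -/
def nyquistTrajectorySets {d : ℕ} (Ω : Set (E d)) : Set (Set (ℝ → E d)) :=
  {P | IsTrajectorySet P ∧ NyquistCondition Ω P ∧ NonDegenerate P}

/-! ### Uniform sets -/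

/-- The lines `p_m(t) = m₁ v₁ + ⋯ + m_n v_n + t v_{n+1}`, for `m ∈ ℤ^n`, in `ℝ^{n+1}`. -/
def lineSet {n : ℕ} (v : Fin (n + 1) → E (n + 1)) : Set (ℝ → E (n + 1)) :=
  Set.range fun (m : Fin n → ℤ) (t : ℝ) =>
    (∑ i : Fin n, (m i : ℝ) • v i.castSucc) + t • v (Fin.last n)

/-- A uniform set in `ℝ^{n+1}`: the lines given by a basis whose last vector is a unit vector
orthogonal to the others. -/
def IsUniformSet {n : ℕ} (P : Set (ℝ → E (n + 1))) : Prop :=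
  ∃ v : Module.Basis (Fin (n + 1)) ℝ (E (n + 1)),
    (∀ i, inner ℝ (v i) (v (Fin.last n)) = if i = Fin.last n then 1 else 0) ∧ P = lineSet v

/-- The uniform sets that are Nyquist trajectory sets for `Ω`. -/
def nyquistUniformSets {n : ℕ} (Ω : Set (E (n + 1))) : Set (Set (ℝ → E (n + 1))) :=
  {P | IsUniformSet P ∧ P ∈ nyquistTrajectorySets Ω}

/-! ### Sampling lattices -/

/-- The lattice of integer combinations of `w₁, …, w_n`. -/
def latticePoints {n : ℕ} (w : Fin n → E n) : Set (E n) :=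
  Set.range fun m : Fin n → ℤ => ∑ i, (m i : ℝ) • w i

/-- The basis `w` of `ℝ^n` generates a sampling lattice for `K`. -/
def GeneratesSamplingLattice {n : ℕ} (K : Set (E n)) (w : Module.Basis (Fin n) ℝ (E n)) : Prop :=
  Determines K (latticePoints w)

/-- The sampling density of a set of points: the average number of points per unit volume. -/
def samplingDensity {n : ℕ} (b : Set (E n)) : ℝ≥0∞ :=
  limsup (fun a : ℝ => ((b ∩ Metric.closedBall 0 a).encard : ℝ≥0∞) /
    volume (Metric.closedBall (0 : E n) a)) atTop

/-- The infimum of the sampling densities of the sampling lattices for `K`. -/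
def minSamplingDensity {n : ℕ} (K : Set (E n)) : ℝ≥0∞ :=
  ⨅ (w : Module.Basis (Fin n) ℝ (E n)) (_ : GeneratesSamplingLattice K w),
    samplingDensity (latticePoints w)

/-! ### Slices and the construction -/

/-- `s ↦ (s, 0)`. -/
def appendZero {n : ℕ} (s : E n) : E (n + 1) :=
  WithLp.toLp 2 (Fin.snoc (α := fun _ => ℝ) s.ofLp 0)

/-- The slice `{s ∈ ℝ^n : U⁻¹ (s, 0) ∈ Ω}` for an orthogonal transformation `U` of `ℝ^{n+1}`. -/
def slice {n : ℕ} (Ω : Set (E (n + 1))) (U : E (n + 1) ≃ₗᵢ[ℝ] E (n + 1)) : Set (E n) :=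
  {s | U.symm (appendZero s) ∈ Ω}

/-- The slice of `Ω` given by `U` admits the sparsest sampling lattices, among all `U`. -/
def IsOptimalRotation {n : ℕ} (Ω : Set (E (n + 1))) (U : E (n + 1) ≃ₗᵢ[ℝ] E (n + 1)) : Prop :=
  ∀ V : E (n + 1) ≃ₗᵢ[ℝ] E (n + 1),
    minSamplingDensity (slice Ω U) ≤ minSamplingDensity (slice Ω V)

/-- The lines along `U⁻¹ e^{n+1}` through the points of the lattice generated by
`U⁻¹ (w_1, 0), …, U⁻¹ (w_n, 0)`. -/
def rotatedLineSet {n : ℕ} (U : E (n + 1) ≃ₗᵢ[ℝ] E (n + 1)) (w : Fin n → E n) :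
    Set (ℝ → E (n + 1)) :=
  lineSet (Fin.snoc (α := fun _ => E (n + 1)) (fun i => U.symm (appendZero (w i)))
    (U.symm (EuclideanSpace.single (Fin.last n) 1)))

end PathSampling

end

open PathSampling

namespace PathSampling

/-! Everything rests on a packing criterion in frequency space. For bounded, convex, symmetric `K`,
a lattice determines the fields bandlimited to `K` exactly when no nonzero `l` in 2π times its dual
lattice has `l/2` in the interior of `K` (`Admissible`). If this holds, distinct interior
frequencies have distinct phases on the lattice, so there is no aliasing and the samples fix the
spectrum (`determines_of_admissible`). If it fails, with μ = `l/2`, a nonzero bandlimited field of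
the form g(x) sin⟨μ, x⟩ vanishes on the lattice (`admissible_of_determines`).

For parallel lines over a lattice `w` the same criterion, applied to the slice of `Ω` orthogonal to
the lines, decides the Nyquist condition. Fine sampling along the lines pushes all other dual points
too far out to matter (`nyquistCondition_of_admissible`). Conversely, a bad μ in the slice is
orthogonal to the lines, so sin⟨μ, x⟩ vanishes on whole lines (`admissible_slice_of_nyquist`). This
converse is applied when `Ω` has an interior; a flat `Ω` has a null slice, so the optimal density is
0 and the lower bound is trivial.

Path density and sampling density both equal the reciprocal of the cell volume of `w`, and every
uniform set is a rotated line set, so minimising over uniform sets is minimising over rotations and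
sampling lattices. Non-degeneracy holds because O(a^n) chords of a ball can be visited in an order
where each link costs O(√a).

An optimal rotation exists because the orthogonal group is compact and the minimal density of the
slice is lower semicontinuous: nearby slices contain each other up to a dilation close to 1, and
dilation scales the minimal density (`mul_minSamplingDensity_le`). -/

/-! ### Bandlimited fields as inverse transforms of integrable spectra. -/

/-- On integrable functions the inverse Fourier transform is self-adjoint. -/
theorem integral_fourierInv_smul_eq {k : ℕ} (g F : E k → ℂ) (hg : Integrable g)
    (hF : Integrable F) : ∫ ξ, (𝓕⁻ g) ξ • F ξ = ∫ x, g x • (𝓕⁻ F) x := by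
  have h := VectorFourier.integral_fourierIntegral_smul_eq_flip (μ := volume) (ν := volume)
    (L := -innerₗ (E k)) (e := Real.fourierChar) Real.continuous_fourierChar
    (continuous_inner (𝕜 := ℝ) (E := E k)).neg hg hF
  have e1 : ∀ (u : E k → ℂ) ξ,
      VectorFourier.fourierIntegral Real.fourierChar volume (-innerₗ (E k)) u ξ = (𝓕⁻ u) ξ := by
    intro u ξ
    simp [VectorFourier.fourierIntegral, Real.fourierInv_eq]
  have e2 : ∀ (u : E k → ℂ) ξ,
      VectorFourier.fourierIntegral Real.fourierChar volume (-innerₗ (E k)).flip u ξ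
        = (𝓕⁻ u) ξ := by
    intro u ξ
    simp [VectorFourier.fourierIntegral, Real.fourierInv_eq, real_inner_comm]
  simpa only [e1, e2] using h

theorem continuous_fourierInv_of_integrable {k : ℕ} {F : E k → ℂ} (hF : Integrable F) :
    Continuous (𝓕⁻ F) := by
  have h := VectorFourier.fourierIntegral_continuous (μ := volume)
    (L := -innerₗ (E k)) (e := Real.fourierChar) Real.continuous_fourierChar
    (continuous_inner (𝕜 := ℝ) (E := E k)).neg hF
  have e : 𝓕⁻ F = VectorFourier.fourierIntegral Real.fourierChar volume (-innerₗ (E k)) F := by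
    funext ξ
    simp [VectorFourier.fourierIntegral, Real.fourierInv_eq]
  rwa [e]

theorem Bandlimited.exists_eq_fourierInv {k : ℕ} {K : Set (E k)} (hK : Bornology.IsBounded K)
    {f : E k → ℂ} (hf : f ∈ Bandlimited K) :
    ∃ F : E k → ℂ, Integrable F ∧ (∀ᵐ ξ, (2 * Real.pi) • ξ ∉ K → F ξ = 0) ∧ f = 𝓕⁻ F := by
  obtain ⟨hcont, hf2, hband⟩ := hf
  set F : Lp ℂ 2 (volume : Measure (E k)) := 𝓕 (hf2.toLp f) with hFdef
  -- On a bounded set L² implies L¹; since 2π ≥ 1, a ball about 0 containing `K` also contains the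
  -- rescaled spectrum.
  have hFint : Integrable F := by
    obtain ⟨R, hR⟩ := hK.subset_closedBall 0
    have hsub : ∀ᵐ ξ, ξ ∉ Metric.closedBall (0 : E k) R → F ξ = 0 := by
      filter_upwards [hband] with ξ hξ hn
      apply hξ
      intro hmem
      apply hn
      have := hR hmem
      rw [mem_closedBall_zero_iff, norm_smul] at this
      rw [mem_closedBall_zero_iff]
      have h1 : 1 ≤ ‖2 * Real.pi‖ := by
        rw [Real.norm_of_nonneg (by positivity)]
        linarith [Real.pi_gt_three]
      nlinarith [norm_nonneg ξ]
    have hon : IntegrableOn F (Metric.closedBall (0 : E k) R) := by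
      have : IsFiniteMeasure (volume.restrict (Metric.closedBall (0 : E k) R)) :=
        ⟨by simpa using measure_closedBall_lt_top⟩
      exact ((Lp.memLp F).restrict _).integrable (by norm_num)
    have := (integrableOn_iff_integrable_of_support_subset
      (f := (Metric.closedBall (0 : E k) R).indicator F)
      (Set.support_indicator_subset)).1 (by
        rw [integrableOn_congr_fun (g := F) (fun x hx => Set.indicator_of_mem hx _)
          Metric.isClosed_closedBall.measurableSet]
        exact hon)
    refine this.congr ?_
    filter_upwards [hsub] with ξ hξ
    by_cases h : ξ ∈ Metric.closedBall (0 : E k) R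
    · rw [Set.indicator_of_mem h]
    · rw [Set.indicator_of_notMem h, hξ h]
  refine ⟨F, hFint, hband, ?_⟩
  -- Both sides agree against every test function: the inverse transform is moved onto the test
  -- function as a tempered distribution, then back by self-adjointness.
  have hae : f =ᵐ[volume] 𝓕⁻ (F : E k → ℂ) := by
    apply ae_eq_of_integral_contDiff_smul_eq
    · exact hcont.locallyIntegrable
    · exact (continuous_fourierInv_of_integrable hFint).locallyIntegrable
    intro g hg hgc
    have hg1 : ContDiff ℝ ((⊤ : ℕ∞) : WithTop ℕ∞) (fun x => (g x : ℂ)) :=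
      Complex.ofRealCLM.contDiff.comp hg
    have hg2 : HasCompactSupport (fun x => (g x : ℂ)) :=
      hgc.comp_left (g := fun x : ℝ => (x : ℂ)) (by simp)
    let G : SchwartzMap (E k) ℂ := hg2.toSchwartzMap hg1
    have hG : ∀ x, G x = (g x : ℂ) := fun x => rfl
    have h1 : ∫ x, G x • (hf2.toLp f : Lp ℂ 2 (volume : Measure (E k))) x = ∫ ξ, (𝓕⁻ G) ξ • F ξ := by
      rw [← Lp.toTemperedDistribution_apply, ← Lp.toTemperedDistribution_apply]
      rw [← TemperedDistribution.fourierInv_apply, Lp.fourierInv_toTemperedDistribution_eq, hFdef,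
        FourierTransform.fourierInv_fourier_eq]
    have h2 : ∫ x, G x • (hf2.toLp f : Lp ℂ 2 (volume : Measure (E k))) x = ∫ x, g x • f x := by
      apply integral_congr_ae
      filter_upwards [hf2.coeFn_toLp] with x hx
      rw [hx, hG]; simp
    rw [← h2, h1]
    have h3 := integral_fourierInv_smul_eq (G : E k → ℂ) F G.integrable hFint
    rw [SchwartzMap.fourierInv_coe, h3]
    apply integral_congr_ae
    filter_upwards with x
    rw [hG]; simp
  exact (Continuous.ae_eq_iff_eq volume hcont (continuous_fourierInv_of_integrable hFint)).1 hae

theorem Bandlimited.sub {k : ℕ} {K : Set (E k)} {f g : E k → ℂ} (hf : f ∈ Bandlimited K)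
    (hg : g ∈ Bandlimited K) : f - g ∈ Bandlimited K := by
  obtain ⟨hf0, hf1, hf2⟩ := hf
  obtain ⟨hg0, hg1, hg2⟩ := hg
  refine ⟨hf0.sub hg0, hf1.sub hg1, ?_⟩
  have : (𝓕 ((hf1.sub hg1).toLp (f - g)) : Lp ℂ 2 (volume : Measure (E k)))
      = 𝓕 (hf1.toLp f) - 𝓕 (hg1.toLp g) := by
    rw [MemLp.toLp_sub]
    exact (Lp.fourierTransformₗᵢ (E k) ℂ).map_sub _ _
  rw [this]
  filter_upwards [hf2, hg2, Lp.coeFn_sub (𝓕 (hf1.toLp f)) (𝓕 (hg1.toLp g))] with ξ h1 h2 h3 hn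
  rw [h3, Pi.sub_apply, h1 hn, h2 hn, sub_zero]

theorem Bandlimited.zero_mem {k : ℕ} (K : Set (E k)) : (0 : E k → ℂ) ∈ Bandlimited K := by
  refine ⟨continuous_zero, MemLp.zero, ?_⟩
  have : (𝓕 ((MemLp.zero : MemLp (0 : E k → ℂ) 2 volume).toLp 0) :
      Lp ℂ 2 (volume : Measure (E k))) = 0 := by
    rw [MemLp.toLp_zero]
    exact (Lp.fourierTransformₗᵢ (E k) ℂ).map_zero
  rw [this]
  filter_upwards [Lp.coeFn_zero ℂ 2 (volume : Measure (E k))] with ξ h _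
  rw [h]; rfl

theorem determines_iff {k : ℕ} {K Λ : Set (E k)} :
    Determines K Λ ↔ ∀ f ∈ Bandlimited K, (∀ x ∈ Λ, f x = 0) → f = 0 := by
  constructor
  · intro h f hf h0
    exact h f hf 0 (Bandlimited.zero_mem K) h0
  · intro h f hf g hg hfg
    exact sub_eq_zero.1 (h (f - g) (Bandlimited.sub hf hg) fun x hx => by simp [hfg x hx])

/-- A spectrum living on a null set is zero almost everywhere, so the only field is 0. This settles
flat `Ω`. -/
theorem determines_of_volume_eq_zero {k : ℕ} {K : Set (E k)} (hK : Bornology.IsBounded K)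
    (h0 : volume K = 0) (Λ : Set (E k)) : Determines K Λ := by
  rw [determines_iff]
  intro f hf _
  obtain ⟨F, -, hF, rfl⟩ := Bandlimited.exists_eq_fourierInv hK hf
  have hnull : ∀ᵐ ξ : E k, (2 * Real.pi) • ξ ∉ K := by
    rw [ae_iff]
    have : {ξ : E k | ¬ (2 * Real.pi) • ξ ∉ K} = (fun ξ => (2 * Real.pi) • ξ) ⁻¹' K := by
      ext; simp
    rw [this, Measure.addHaar_preimage_smul _ (by positivity), h0, mul_zero]
  have : F =ᵐ[volume] 0 := by
    filter_upwards [hF, hnull] with ξ h1 h2 using h1 h2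
  ext x
  rw [Real.fourierInv_eq]
  rw [integral_congr_ae (g := fun _ => 0)]
  · simp
  · filter_upwards [this] with ξ h
    rw [h]; simp

/-! ### The packing criterion for sampling lattices. -/

/-- No nonzero `λ` with all `⟪λ, w i⟫ ∈ 2πℤ` has its half in the interior of `K`: the translates
of the interior of a symmetric convex `K` by the dual lattice are disjoint. -/
def Admissible {k : ℕ} (K : Set (E k)) (w : Fin k → E k) : Prop :=
  ∀ l : E k, l ≠ 0 → (∀ i, ∃ j : ℤ, inner ℝ l (w i) = 2 * Real.pi * j) →
    (1 / 2 : ℝ) • l ∉ interior K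

/-- The phases `⟪ξ, w i⟫` modulo one. -/
noncomputable def phases {k : ℕ} (w : Fin k → E k) (ξ : E k) : UnitAddTorus (Fin k) :=
  fun i => ((inner ℝ ξ (w i) : ℝ) : UnitAddCircle)

theorem continuous_phases {k : ℕ} (w : Fin k → E k) : Continuous (phases w) := by
  unfold phases
  refine continuous_pi fun i => ?_
  exact (AddCircle.continuous_mk' (1 : ℝ)).comp (continuous_id.inner continuous_const)

/-- Samples on the lattice thereby become integrals of the spectrum against trigonometric monomials
of the phases. -/
theorem mFourier_phases {k : ℕ} (w : Fin k → E k) (m : Fin k → ℤ) (ξ : E k) :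
    UnitAddTorus.mFourier m (phases w ξ)
      = (Real.fourierChar (inner ℝ ξ (∑ i, (m i : ℝ) • w i)) : ℂ) := by
  simp only [UnitAddTorus.mFourier, ContinuousMap.coe_mk, phases, fourier_coe_apply,
    Real.fourierChar_apply, ← Complex.exp_sum, inner_sum, inner_smul_right]
  congr 1
  push_cast
  rw [Finset.mul_sum, Finset.sum_mul]
  refine Finset.sum_congr rfl fun i _ => ?_
  simp
  ring

/-- An integrable function whose inverse transform vanishes on the lattice is orthogonal to all
continuous functions of the phases. -/
theorem integral_comp_phases_eq_zero {k : ℕ} {w : Fin k → E k} {F : E k → ℂ} (hF : Integrable F)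
    (h : ∀ x ∈ latticePoints w, (𝓕⁻ F) x = 0) (φ : C(UnitAddTorus (Fin k), ℂ)) :
    ∫ ξ, φ (phases w ξ) * F ξ = 0 := by
  have hint : ∀ φ : C(UnitAddTorus (Fin k), ℂ), Integrable fun ξ => φ (phases w ξ) * F ξ := by
    intro φ
    refine hF.bdd_mul (c := ‖φ‖) ?_ ?_
    · exact (φ.continuous.comp (continuous_phases w)).aestronglyMeasurable
    · exact Eventually.of_forall fun ξ => φ.norm_coe_le_norm _
  let T : C(UnitAddTorus (Fin k), ℂ) →ₗ[ℂ] ℂ :=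
    { toFun := fun φ => ∫ ξ, φ (phases w ξ) * F ξ
      map_add' := fun a b => by
        simp only [ContinuousMap.add_apply, add_mul]
        exact integral_add (hint a) (hint b)
      map_smul' := fun c a => by
        simp only [ContinuousMap.smul_apply, smul_eq_mul, RingHom.id_apply, mul_assoc]
        exact integral_const_mul _ _ }
  let T' : C(UnitAddTorus (Fin k), ℂ) →L[ℂ] ℂ := T.mkContinuous (∫ ξ, ‖F ξ‖) (by
    intro φ
    refine (norm_integral_le_integral_norm _).trans ?_
    rw [← integral_mul_const]
    refine integral_mono (hint φ).norm (hF.norm.mul_const _) fun ξ => ?_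
    simp only [norm_mul]
    rw [mul_comm]
    exact mul_le_mul_of_nonneg_left (φ.norm_coe_le_norm _) (norm_nonneg _))
  -- The functional is bounded by the L¹ norm of `F` and kills the monomials, whose span is dense in
  -- the continuous functions on the torus.
  have hT : T' = 0 := by
    apply ContinuousLinearMap.ext_on (s := Set.range (UnitAddTorus.mFourier (d := Fin k)))
    · rw [dense_iff_closure_eq]
      have := UnitAddTorus.span_mFourier_closure_eq_top (d := Fin k)
      rw [← Submodule.topologicalClosure_coe, this]
      rfl
    · rintro _ ⟨m, rfl⟩
      have := h _ ⟨m, rfl⟩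
      rw [Real.fourierInv_eq] at this
      change ∫ ξ, UnitAddTorus.mFourier m (phases w ξ) * F ξ = 0
      simp_rw [mFourier_phases]
      exact this
  exact congrArg (fun S : C(UnitAddTorus (Fin k), ℂ) →L[ℂ] ℂ => S φ) hT

/-- An integrable function that lives on a set where the phases are injective is determined by
the values of its inverse transform on the lattice. -/
theorem ae_eq_zero_of_fourierInv_eq_zero {k : ℕ} {w : Fin k → E k} {F : E k → ℂ}
    (hF : Integrable F) (h : ∀ x ∈ latticePoints w, (𝓕⁻ F) x = 0) {D : Set (E k)}
    (hD : IsOpen D) (hinj : Set.InjOn (phases w) D) (hsupp : ∀ᵐ ξ, ξ ∉ D → F ξ = 0) :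
    F =ᵐ[volume] 0 := by
  -- By injectivity, on `D` the indicator of `s` is that of the closed set `phases w '' s` pulled
  -- back. The latter is a bounded limit of continuous functions of the phases, each orthogonal to
  -- `F`.
  have key : ∀ s : Set (E k), IsCompact s → s ⊆ D → ∫ ξ in s, F ξ = 0 := by
    intro s hs hsD
    have hc : IsClosed (phases w '' s) := (hs.image (continuous_phases w)).isClosed
    have hlim : Tendsto (fun n : ℕ => ∫ ξ, ((hc.apprSeq n (phases w ξ) : NNReal) : ℂ) * F ξ) atTop
        (𝓝 (∫ ξ, s.indicator F ξ)) := by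
      refine tendsto_integral_of_dominated_convergence (fun ξ => ‖F ξ‖) ?_ hF.norm ?_ ?_
      · intro n
        refine AEStronglyMeasurable.mul ?_ hF.aestronglyMeasurable
        refine Continuous.aestronglyMeasurable ?_
        exact Complex.continuous_ofReal.comp (NNReal.continuous_coe.comp
          ((hc.apprSeq n).continuous.comp (continuous_phases w)))
      · intro n
        filter_upwards with ξ
        rw [norm_mul]
        refine mul_le_of_le_one_left (norm_nonneg _) ?_
        have := HasOuterApproxClosed.apprSeq_apply_le_one hc n (phases w ξ)
        simpa using this
      · filter_upwards [hsupp] with ξ hξ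
        by_cases hD' : ξ ∈ D
        · have h1 := (tendsto_pi_nhds.1 (HasOuterApproxClosed.tendsto_apprSeq hc)) (phases w ξ)
          have h2 : Tendsto (fun n : ℕ => ((hc.apprSeq n (phases w ξ) : NNReal) : ℂ)) atTop
              (𝓝 (((phases w '' s).indicator (fun _ => (1 : NNReal)) (phases w ξ) : NNReal) : ℂ)) :=
            ((Complex.continuous_ofReal.comp NNReal.continuous_coe).tendsto _).comp h1
          have h3 := h2.mul_const (F ξ)
          convert h3 using 2
          by_cases hm : ξ ∈ s
          · rw [Set.indicator_of_mem hm, Set.indicator_of_mem (Set.mem_image_of_mem _ hm)]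
            simp
          · rw [Set.indicator_of_notMem hm, Set.indicator_of_notMem]
            · simp
            · rintro ⟨η, hη, he⟩
              exact hm (hinj (hsD hη) hD' he ▸ hη)
        · rw [hξ hD']
          have : s.indicator F ξ = 0 := Set.indicator_of_notMem (fun hm => hD' (hsD hm)) _
          rw [this]
          simp
    have hzero : ∀ n : ℕ, ∫ ξ, ((hc.apprSeq n (phases w ξ) : NNReal) : ℂ) * F ξ = 0 := by
      intro n
      exact integral_comp_phases_eq_zero hF h
        ⟨fun y => ((hc.apprSeq n y : NNReal) : ℂ), Complex.continuous_ofReal.comp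
          (NNReal.continuous_coe.comp (hc.apprSeq n).continuous)⟩
    simp_rw [hzero] at hlim
    rw [← integral_indicator hs.measurableSet]
    exact (tendsto_nhds_unique hlim tendsto_const_nhds)
  have hDae : ∀ᵐ ξ, ξ ∈ D → F ξ = 0 := by
    obtain ⟨C, hC, hCs, hCD, -⟩ := hD.exists_iUnion_isClosed
    have hn : ∀ n, ∀ᵐ ξ, (C n).indicator F ξ = 0 := by
      intro n
      refine ae_eq_zero_of_forall_setIntegral_isCompact_eq_zero
        (hF.indicator (hC n).measurableSet) fun s hs => ?_
      rw [setIntegral_indicator (hC n).measurableSet]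
      exact key _ (hs.inter_right (hC n)) (Set.inter_subset_right.trans (hCs n))
    filter_upwards [ae_all_iff.2 hn] with ξ h1 h2
    rw [← hCD] at h2
    obtain ⟨n, hmem⟩ := Set.mem_iUnion.1 h2
    rw [← h1 n, Set.indicator_of_mem hmem]
  filter_upwards [hDae, hsupp] with ξ h1 h2
  by_cases hm : ξ ∈ D
  · exact h1 hm
  · exact h2 hm

theorem neg_mem_interior {k : ℕ} {K : Set (E k)} (hsymm : ∀ x ∈ K, -x ∈ K) {x : E k}
    (hx : x ∈ interior K) : -x ∈ interior K := by
  have hsub : -interior K ⊆ interior K := by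
    apply interior_maximal
    · intro x hx
      simpa using hsymm _ (interior_subset hx)
    · exact isOpen_interior.neg
  exact hsub (by simpa using hx)

/-- If ξ and η share their phases then 2π(ξ - η) is in the scaled dual lattice, and its half is the
midpoint of 2πξ and -2πη, hence interior by symmetry and convexity. -/
theorem injOn_phases_of_admissible {k : ℕ} {K : Set (E k)} (hconv : Convex ℝ K)
    (hsymm : ∀ x ∈ K, -x ∈ K) {w : Fin k → E k} (hw : Admissible K w) :
    Set.InjOn (phases w) {ξ | (2 * Real.pi) • ξ ∈ interior K} := by
  intro ξ hξ η hη heq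
  by_contra hne
  have hpi : (2 * Real.pi : ℝ) ≠ 0 := by positivity
  have hneg : (-(2 * Real.pi)) • η ∈ interior K := by
    rw [neg_smul]
    exact neg_mem_interior hsymm hη
  refine hw ((2 * Real.pi) • (ξ - η)) (smul_ne_zero hpi (sub_ne_zero.2 hne)) (fun i => ?_) ?_
  · have hi := congrFun heq i
    simp only [phases] at hi
    rw [← sub_eq_zero, ← AddCircle.coe_sub, AddCircle.coe_eq_zero_iff] at hi
    obtain ⟨j, hj⟩ := hi
    refine ⟨j, ?_⟩
    rw [inner_smul_left, inner_sub_left, ← hj]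
    simp
  · have := hconv.interior hξ hneg (a := 1 / 2) (b := 1 / 2) (by norm_num) (by norm_num)
      (by norm_num)
    convert this using 1
    module

/-- The frontier of a convex set is null, so the spectrum lives on the interior, where the phases
are injective. -/
theorem determines_of_admissible {k : ℕ} {K : Set (E k)} (hbdd : Bornology.IsBounded K)
    (hconv : Convex ℝ K) (hsymm : ∀ x ∈ K, -x ∈ K) {w : Fin k → E k} (hw : Admissible K w) :
    Determines K (latticePoints w) := by
  rw [determines_iff]
  intro f hf h0
  obtain ⟨F, hF, hband, rfl⟩ := Bandlimited.exists_eq_fourierInv hbdd hf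
  have hcont : Continuous fun ξ : E k => (2 * Real.pi) • ξ := continuous_const_smul _
  have hfr : ∀ᵐ ξ : E k, (2 * Real.pi) • ξ ∉ frontier K := by
    rw [ae_iff]
    have : {ξ : E k | ¬ (2 * Real.pi) • ξ ∉ frontier K}
        = (fun ξ => (2 * Real.pi) • ξ) ⁻¹' frontier K := by
      ext; simp
    rw [this, Measure.addHaar_preimage_smul _ (by positivity), hconv.addHaar_frontier volume, mul_zero]
  have hz : F =ᵐ[volume] 0 := by
    refine ae_eq_zero_of_fourierInv_eq_zero hF h0 (isOpen_interior.preimage hcont)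
      (injOn_phases_of_admissible hconv hsymm hw) ?_
    filter_upwards [hband, hfr] with ξ h1 h2 h3
    refine h1 fun h4 => h2 ?_
    exact ⟨subset_closure h4, h3⟩
  ext x
  rw [Real.fourierInv_eq, integral_congr_ae (g := fun _ => 0)]
  · simp
  · filter_upwards [hz] with ξ h
    rw [h]; simp

/-- A nonzero bandlimited field of the form `g(x) sin ⟪μ, x⟫`. -/
theorem Bandlimited.exists_ne_zero_of_sin_eq_zero {k : ℕ} {K : Set (E k)} {μ : E k} (h0 : μ ≠ 0)
    (h1 : μ ∈ interior K) (h2 : -μ ∈ interior K) :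
    ∃ f ∈ Bandlimited K, f ≠ 0 ∧ ∀ x, Real.sin (inner ℝ μ x) = 0 → f x = 0 := by
  set c : E k := (2 * Real.pi)⁻¹ • μ with hc
  have hpi : (2 * Real.pi : ℝ) ≠ 0 := by positivity
  have hcμ : (2 * Real.pi) • c = μ := by rw [hc, smul_inv_smul₀ hpi]
  have hc0 : c ≠ 0 := smul_ne_zero (inv_ne_zero hpi) h0
  have hW : IsOpen {ξ : E k | (2 * Real.pi) • ξ ∈ interior K} :=
    isOpen_interior.preimage (continuous_const_smul _)
  obtain ⟨ε₁, hε₁, hb₁⟩ := Metric.isOpen_iff.1 hW c (by simpa [hcμ] using h1)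
  obtain ⟨ε₂, hε₂, hb₂⟩ := Metric.isOpen_iff.1 hW (-c) (by simpa [hcμ] using h2)
  -- Bumps of radius ε about ±c stay inside the allowed band, and ε ≤ ‖c‖ keeps the bump about -c
  -- from reaching c.
  set ε := min (min ε₁ ε₂) ‖c‖ with hε
  have hεpos : 0 < ε := lt_min (lt_min hε₁ hε₂) (norm_pos_iff.2 hc0)
  let χ : ContDiffBump (0 : E k) := ⟨ε / 2, ε, by positivity, by linarith⟩
  have hsm : ContDiff ℝ ((⊤ : ℕ∞) : WithTop ℕ∞) (fun ξ : E k => (χ ξ : ℂ)) :=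
    Complex.ofRealCLM.contDiff.comp χ.contDiff
  have hcs : HasCompactSupport (fun ξ : E k => (χ ξ : ℂ)) :=
    χ.hasCompactSupport.comp_left (g := fun x : ℝ => (x : ℂ)) (by simp)
  have hint : Integrable (fun ξ : E k => (χ ξ : ℂ)) := hsm.continuous.integrable_of_hasCompactSupport hcs
  -- The inverse transform of this difference of translates is 2i sin⟨μ, x⟩ times that of the bump.
  let φ₀ : E k → ℂ := fun ξ => (χ (ξ - c) : ℂ) - (χ (ξ + c) : ℂ)
  have hφsm : ContDiff ℝ ((⊤ : ℕ∞) : WithTop ℕ∞) φ₀ :=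
    (hsm.comp (contDiff_id.sub contDiff_const)).sub (hsm.comp (contDiff_id.add contDiff_const))
  have hφcs : HasCompactSupport φ₀ := by
    refine HasCompactSupport.sub ?_ ?_
    · exact hcs.comp_homeomorph (Homeomorph.subRight c)
    · exact hcs.comp_homeomorph (Homeomorph.addRight c)
  let φ : SchwartzMap (E k) ℂ := hφcs.toSchwartzMap hφsm
  have hφ : ∀ ξ, φ ξ = φ₀ ξ := fun ξ => rfl
  have hzero : ∀ ξ : E k, ε ≤ ‖ξ‖ → χ ξ = 0 := fun ξ h => χ.zero_of_le_dist (by simpa using h)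
  refine ⟨(𝓕⁻ φ : SchwartzMap (E k) ℂ), ⟨SchwartzMap.continuous _,
    SchwartzMap.memLp (𝓕⁻ φ : SchwartzMap (E k) ℂ) 2 volume, ?_⟩, ?_, ?_⟩
  · have e : 𝓕 ((SchwartzMap.memLp (𝓕⁻ φ : SchwartzMap (E k) ℂ) 2 volume).toLp
        (𝓕⁻ φ : SchwartzMap (E k) ℂ)) = φ.toLp 2 := by
      change 𝓕 ((𝓕⁻ φ : SchwartzMap (E k) ℂ).toLp 2) = _
      rw [SchwartzMap.toLp_fourier_eq, FourierTransform.fourier_fourierInv_eq]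
    rw [e]
    filter_upwards [φ.coeFn_toLp 2 volume] with ξ hξ hn
    rw [hξ, hφ]
    have n1 : ε ≤ ‖ξ - c‖ := by
      by_contra! hlt
      refine hn (interior_subset (hb₁ ?_))
      rw [mem_ball_iff_norm]
      exact hlt.trans_le ((min_le_left _ _).trans (min_le_left _ _))
    have n2 : ε ≤ ‖ξ + c‖ := by
      by_contra! hlt
      refine hn (interior_subset (hb₂ ?_))
      rw [mem_ball_iff_norm, sub_neg_eq_add]
      exact hlt.trans_le ((min_le_left _ _).trans (min_le_right _ _))
    simp [φ₀, hzero _ n1, hzero _ n2]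
  · intro hf
    have hf' : (𝓕⁻ φ : SchwartzMap (E k) ℂ) = 0 := DFunLike.coe_injective hf
    have : φ = 0 := by
      calc φ = 𝓕 (𝓕⁻ φ : SchwartzMap (E k) ℂ) :=
            (FourierTransform.fourier_fourierInv_eq φ).symm
        _ = 0 := by
          rw [hf']
          exact (FourierTransform.fourierCLM ℂ (SchwartzMap (E k) ℂ)).map_zero
    have hval : φ₀ c = 0 := by rw [← hφ, this]; rfl
    have e1 : χ (0 : E k) = 1 := χ.one_of_mem_closedBall (by simp [χ]; linarith)
    have e2 : χ (c + c) = 0 := by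
      apply hzero
      rw [← two_smul ℝ c, norm_smul]
      have : ε ≤ ‖c‖ := min_le_right _ _
      simp only [Real.norm_ofNat]
      linarith [norm_nonneg c]
    simp [φ₀, e1, e2] at hval
  · intro x hx
    rw [SchwartzMap.fourierInv_coe, Real.fourierInv_eq]
    have t : ∀ v : E k, ∫ ξ, Real.fourierChar (inner ℝ ξ x) • (χ (ξ + v) : ℂ)
        = Real.fourierChar (-inner ℝ v x) • ∫ ξ, Real.fourierChar (inner ℝ ξ x) • (χ ξ : ℂ) := by
      intro v
      rw [Circle.smul_def, ← integral_smul]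
      simp only [← Circle.smul_def]
      rw [← integral_add_right_eq_self (fun ξ =>
        Real.fourierChar (-inner ℝ v x) • Real.fourierChar (inner ℝ ξ x) • (χ ξ : ℂ)) v]
      refine integral_congr_ae (Eventually.of_forall fun ξ => ?_)
      simp only [smul_smul, ← AddChar.map_add_eq_mul, inner_add_left]
      congr 2
      ring
    have i : ∀ v : E k, Integrable fun ξ => Real.fourierChar (inner ℝ ξ x) • (χ (ξ + v) : ℂ) := by
      intro v
      have := (Real.fourierIntegral_convergent_iff (f := fun ξ => (χ (ξ + v) : ℂ)) (-x)).2
        (hint.comp_add_right v)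
      simpa using this
    have key : ∫ ξ, Real.fourierChar (inner ℝ ξ x) • φ ξ = (∫ ξ, Real.fourierChar (inner ℝ ξ x) •
        (χ (ξ + -c) : ℂ)) - ∫ ξ, Real.fourierChar (inner ℝ ξ x) • (χ (ξ + c) : ℂ) := by
      rw [← integral_sub (i (-c)) (i c)]
      refine integral_congr_ae (Eventually.of_forall fun ξ => ?_)
      simp only [hφ, φ₀, Circle.smul_def, smul_eq_mul, sub_eq_add_neg]
      ring
    rw [key, t, t, sub_eq_zero]
    congr 1
    ext
    simp only [Real.fourierChar_apply]
    rw [Complex.exp_eq_exp_iff_exists_int]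
    obtain ⟨j, hj⟩ := Real.sin_eq_zero_iff.1 hx
    refine ⟨j, ?_⟩
    have e3 : 2 * Real.pi * inner ℝ c x = j * Real.pi := by
      rw [hj, hc, inner_smul_left]
      simp only [conj_trivial]
      field_simp
    have e4 : (2 * Real.pi * (inner ℝ c x : ℝ) : ℂ) = j * Real.pi := by exact_mod_cast e3
    simp only [inner_neg_left, neg_neg]
    push_cast
    linear_combination 2 * Complex.I * e4

theorem not_determines_of_sin_eq_zero {k : ℕ} {K Λ : Set (E k)} {μ : E k} (h0 : μ ≠ 0)
    (h1 : μ ∈ interior K) (h2 : -μ ∈ interior K)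
    (hΛ : ∀ x ∈ Λ, Real.sin (inner ℝ μ x) = 0) : ¬ Determines K Λ := by
  rw [determines_iff]
  intro h
  obtain ⟨f, hf, hne, hz⟩ := Bandlimited.exists_ne_zero_of_sin_eq_zero h0 h1 h2
  exact hne (h f hf fun x hx => hz x (hΛ x hx))

/-- For a forbidden `l`, the frequency μ = `l/2` has ⟨μ, x⟩ ∈ πℤ at every lattice point, so the sine
field cannot be told from 0. -/
theorem admissible_of_determines {k : ℕ} {K : Set (E k)} (hsymm : ∀ x ∈ K, -x ∈ K)
    {w : Fin k → E k} (h : Determines K (latticePoints w)) : Admissible K w := by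
  intro l hl hint hmem
  refine not_determines_of_sin_eq_zero (smul_ne_zero (by norm_num) hl) hmem
    (neg_mem_interior hsymm hmem) ?_ h
  rintro _ ⟨m, rfl⟩
  choose j hj using hint
  rw [Real.sin_eq_zero_iff]
  refine ⟨∑ i, m i * j i, ?_⟩
  simp only [inner_sum, inner_smul_left, inner_smul_right, hj]
  push_cast
  rw [Finset.sum_mul]
  refine Finset.sum_congr rfl fun i _ => ?_
  simp
  ring

/-! ### Coordinates along the lines, slices and uniform sets. -/

/-- The point `U⁻¹ (s, t)`. -/
noncomputable def place {n : ℕ} (U : E (n + 1) ≃ₗᵢ[ℝ] E (n + 1)) : E n × ℝ →ₗ[ℝ] E (n + 1) where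
  toFun p := U.symm (WithLp.toLp 2 (Fin.snoc (α := fun _ => ℝ) p.1.ofLp p.2))
  map_add' p q := by
    rw [← map_add]
    congr 1
    ext i
    refine Fin.lastCases ?_ (fun j => ?_) i <;> simp
  map_smul' c p := by
    rw [RingHom.id_apply, ← map_smul]
    congr 1
    ext i
    refine Fin.lastCases ?_ (fun j => ?_) i <;> simp

theorem place_apply {n : ℕ} (U : E (n + 1) ≃ₗᵢ[ℝ] E (n + 1)) (s : E n) (t : ℝ) :
    place U (s, t) = U.symm (WithLp.toLp 2 (Fin.snoc (α := fun _ => ℝ) s.ofLp t)) := rfl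

theorem place_zero_right {n : ℕ} (U : E (n + 1) ≃ₗᵢ[ℝ] E (n + 1)) (s : E n) :
    place U (s, 0) = U.symm (appendZero s) := rfl

theorem place_zero_left {n : ℕ} (U : E (n + 1) ≃ₗᵢ[ℝ] E (n + 1)) :
    place U (0, 1) = U.symm (EuclideanSpace.single (Fin.last n) 1) := by
  rw [place_apply]
  congr 1
  ext i
  refine Fin.lastCases ?_ (fun j => ?_) i <;> simp [Fin.castSucc_ne_last]

theorem inner_place {n : ℕ} (U : E (n + 1) ≃ₗᵢ[ℝ] E (n + 1)) (p q : E n × ℝ) :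
    inner ℝ (place U p) (place U q) = inner ℝ p.1 q.1 + p.2 * q.2 := by
  obtain ⟨s, t⟩ := p
  obtain ⟨s', t'⟩ := q
  rw [place_apply, place_apply, LinearIsometryEquiv.inner_map_map]
  simp [PiLp.inner_apply, Fin.sum_univ_castSucc, mul_comm]

theorem norm_place_sq {n : ℕ} (U : E (n + 1) ≃ₗᵢ[ℝ] E (n + 1)) (p : E n × ℝ) :
    ‖place U p‖ ^ 2 = ‖p.1‖ ^ 2 + p.2 ^ 2 := by
  rw [← real_inner_self_eq_norm_sq, inner_place, real_inner_self_eq_norm_sq, sq p.2]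

theorem norm_place_le {n : ℕ} (U : E (n + 1) ≃ₗᵢ[ℝ] E (n + 1)) (p : E n × ℝ) :
    ‖place U p‖ ≤ ‖p.1‖ + |p.2| := by
  refine abs_le_of_sq_le_sq' ?_ (by positivity) |>.2
  rw [norm_place_sq, ← sq_abs p.2]
  nlinarith [norm_nonneg p.1, abs_nonneg p.2]

theorem norm_place_zero_right {n : ℕ} (U : E (n + 1) ≃ₗᵢ[ℝ] E (n + 1)) (s : E n) :
    ‖place U (s, 0)‖ = ‖s‖ := by
  rw [← sq_eq_sq₀ (norm_nonneg _) (norm_nonneg _), norm_place_sq]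
  simp

theorem place_injective {n : ℕ} (U : E (n + 1) ≃ₗᵢ[ℝ] E (n + 1)) :
    Function.Injective (place U) := by
  rw [injective_iff_map_eq_zero]
  intro p hp
  have h := norm_place_sq U p
  rw [hp, norm_zero] at h
  have h1 : ‖p.1‖ ^ 2 = 0 := by nlinarith [sq_nonneg ‖p.1‖, sq_nonneg p.2]
  have h2 : p.2 ^ 2 = 0 := by nlinarith [sq_nonneg ‖p.1‖, sq_nonneg p.2]
  ext1
  · simpa using h1
  · simpa using h2

theorem place_surjective {n : ℕ} (U : E (n + 1) ≃ₗᵢ[ℝ] E (n + 1)) :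
    Function.Surjective (place U) := by
  intro x
  refine ⟨(WithLp.toLp 2 (Fin.init (α := fun _ => ℝ) (U x).ofLp), (U x).ofLp (Fin.last n)), ?_⟩
  rw [place_apply]
  simp [Fin.snoc_init_self]

theorem continuous_place {n : ℕ} (U : E (n + 1) ≃ₗᵢ[ℝ] E (n + 1)) : Continuous (place U) :=
  LinearMap.continuous_of_finiteDimensional _

theorem mem_slice_iff {n : ℕ} {Ω : Set (E (n + 1))} {U : E (n + 1) ≃ₗᵢ[ℝ] E (n + 1)} {s : E n} :
    s ∈ slice Ω U ↔ place U (s, 0) ∈ Ω := Iff.rfl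

theorem rotatedLineSet_eq {n : ℕ} (U : E (n + 1) ≃ₗᵢ[ℝ] E (n + 1)) (w : Fin n → E n) :
    rotatedLineSet U w
      = Set.range fun (m : Fin n → ℤ) (t : ℝ) => place U (∑ i, (m i : ℝ) • w i, t) := by
  unfold rotatedLineSet lineSet
  congr 1
  funext m t
  simp only [Fin.snoc_castSucc, Fin.snoc_last, ← place_zero_right, ← place_zero_left, ← map_smul,
    ← map_sum, ← map_add]
  congr 1
  ext1
  · simp [Prod.fst_sum]
  · simp [Prod.snd_sum]

theorem convex_slice {n : ℕ} {Ω : Set (E (n + 1))} (h : Convex ℝ Ω)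
    (U : E (n + 1) ≃ₗᵢ[ℝ] E (n + 1)) : Convex ℝ (slice Ω U) :=
  h.linear_preimage ((place U).comp (LinearMap.inl ℝ (E n) ℝ))

theorem neg_mem_slice {n : ℕ} {Ω : Set (E (n + 1))} (h : ∀ x ∈ Ω, -x ∈ Ω)
    (U : E (n + 1) ≃ₗᵢ[ℝ] E (n + 1)) : ∀ s ∈ slice Ω U, -s ∈ slice Ω U := by
  intro s hs
  rw [mem_slice_iff] at hs ⊢
  have := h _ hs
  rwa [← map_neg, Prod.neg_mk, neg_zero] at this

theorem isBounded_slice {n : ℕ} {Ω : Set (E (n + 1))} (h : Bornology.IsBounded Ω)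
    (U : E (n + 1) ≃ₗᵢ[ℝ] E (n + 1)) : Bornology.IsBounded (slice Ω U) := by
  obtain ⟨R, hR⟩ := h.exists_norm_le
  refine isBounded_iff_forall_norm_le.2 ⟨R, fun s hs => ?_⟩
  rw [← norm_place_zero_right U]
  exact hR _ hs

theorem mem_interior_slice {n : ℕ} {Ω : Set (E (n + 1))} {U : E (n + 1) ≃ₗᵢ[ℝ] E (n + 1)} {s : E n}
    (h : place U (s, 0) ∈ interior Ω) : s ∈ interior (slice Ω U) := by
  have hc : Continuous fun s : E n => place U (s, 0) :=
    (continuous_place U).comp (by fun_prop)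
  exact (interior_maximal (s := slice Ω U) (t := (fun s : E n => place U (s, 0)) ⁻¹' interior Ω)
    (Set.preimage_mono interior_subset) (isOpen_interior.preimage hc)) h

/-- Some `c • s` with `c > 1` is still in the slice, so the point lies strictly between the interior
point 0 and a point of `Ω`. -/
theorem place_mem_interior {n : ℕ} {Ω : Set (E (n + 1))} (hconv : Convex ℝ Ω)
    (h0 : (0 : E (n + 1)) ∈ interior Ω) {U : E (n + 1) ≃ₗᵢ[ℝ] E (n + 1)} {s : E n}
    (h : s ∈ interior (slice Ω U)) : place U (s, 0) ∈ interior Ω := by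
  have hc : ContinuousAt (fun c : ℝ => c • s) 1 := by fun_prop
  have hev : ∀ᶠ c in 𝓝 (1 : ℝ), c • s ∈ slice Ω U := by
    refine hc.eventually_mem ?_
    rw [one_smul]
    exact mem_interior_iff_mem_nhds.1 h
  obtain ⟨c, hcm, hc1⟩ := ((hev.filter_mono nhdsWithin_le_nhds).and
    (self_mem_nhdsWithin (s := Set.Ioi (1 : ℝ)))).exists
  have hc1 : 1 < c := hc1
  rw [mem_slice_iff] at hcm
  have hcp : (0 : ℝ) < c := by linarith
  have := hconv.combo_interior_self_mem_interior h0 hcm (a := 1 - c⁻¹) (b := c⁻¹)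
    (by rw [sub_pos]; exact inv_lt_one_of_one_lt₀ hc1) (by positivity) (by ring)
  have e : place U (c • s, 0) = c • place U (s, 0) := by
    rw [← map_smul]; simp
  rw [e, smul_zero, zero_add, inv_smul_smul₀ hcp.ne'] at this
  exact this

/-- A frequency in the slice hyperplane is orthogonal to the lines, so its sine is constant along
each of them. If it vanishes at the lattice points it vanishes on all lines, whatever sample set `Λ`
is chosen. -/
theorem admissible_slice_of_nyquist {n : ℕ} {Ω : Set (E (n + 1))} (hconv : Convex ℝ Ω)
    (hsymm : ∀ x ∈ Ω, -x ∈ Ω) (h0 : (0 : E (n + 1)) ∈ interior Ω)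
    {U : E (n + 1) ≃ₗᵢ[ℝ] E (n + 1)} {w : Fin n → E n}
    (h : NyquistCondition Ω (rotatedLineSet U w)) : Admissible (slice Ω U) w := by
  obtain ⟨Λ, -, hΛ, hdet⟩ := h
  intro l hl hint hmem
  have hm := place_mem_interior hconv h0 hmem
  have hne : place U ((1 / 2 : ℝ) • l, 0) ≠ 0 := by
    rw [Ne, map_eq_zero_iff _ (place_injective U)]
    intro h
    have := congrArg Prod.fst h
    simp [hl] at this
  refine not_determines_of_sin_eq_zero hne hm (neg_mem_interior hsymm hm) ?_ hdet
  intro x hx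
  obtain ⟨p, hp, t, rfl⟩ := hΛ x hx
  rw [rotatedLineSet_eq] at hp
  obtain ⟨m, rfl⟩ := hp
  choose j hj using hint
  rw [inner_place, Real.sin_eq_zero_iff]
  refine ⟨∑ i, m i * j i, ?_⟩
  simp only [inner_sum, inner_smul_left, inner_smul_right, hj]
  push_cast
  rw [Finset.sum_mul, zero_mul, add_zero]
  refine Finset.sum_congr rfl fun i _ => ?_
  simp
  ring

/-- The lines of a rotated line set, as a basis. -/
theorem exists_basis_snoc {n : ℕ} (U : E (n + 1) ≃ₗᵢ[ℝ] E (n + 1))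
    (w : Module.Basis (Fin n) ℝ (E n)) {τ : ℝ} (hτ : τ ≠ 0) :
    ∃ v : Module.Basis (Fin (n + 1)) ℝ (E (n + 1)),
      (v : Fin (n + 1) → E (n + 1))
        = Fin.snoc (α := fun _ => E (n + 1)) (fun i => place U (w i, 0)) (place U (0, τ)) := by
  have hli : LinearIndependent ℝ
      (Fin.snoc (α := fun _ => E (n + 1)) (fun i => place U (w i, 0)) (place U (0, τ))) := by
    rw [linearIndependent_finSnoc]
    constructor
    · exact w.linearIndependent.map' ((place U).comp (LinearMap.inl ℝ (E n) ℝ))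
        (LinearMap.ker_eq_bot.2 ((place_injective U).comp LinearMap.inl_injective))
    · intro hmem
      have hle : Submodule.span ℝ (Set.range fun i => place U (w i, 0))
          ≤ LinearMap.ker (innerₗ (E (n + 1)) (place U (0, τ))) := by
        rw [Submodule.span_le]
        rintro _ ⟨i, rfl⟩
        simp [inner_place]
      have h := LinearMap.mem_ker.1 (hle hmem)
      rw [innerₗ_apply_apply, inner_place] at h
      simp [hτ] at h
  refine ⟨basisOfLinearIndependentOfCardEqFinrank hli (by simp), ?_⟩
  simp

theorem isUniformSet_rotatedLineSet {n : ℕ} (U : E (n + 1) ≃ₗᵢ[ℝ] E (n + 1))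
    (w : Module.Basis (Fin n) ℝ (E n)) : IsUniformSet (rotatedLineSet U w) := by
  obtain ⟨v, hv⟩ := exists_basis_snoc U w one_ne_zero
  refine ⟨v, fun i => ?_, ?_⟩
  · rw [hv]
    refine Fin.lastCases ?_ (fun j => ?_) i
    · rw [Fin.snoc_last, inner_place]
      simp
    · rw [Fin.snoc_last, Fin.snoc_castSucc, inner_place]
      simp [Fin.castSucc_ne_last]
  · rw [hv]
    simp only [place_zero_right, place_zero_left, rotatedLineSet]

theorem exists_abs_repr_le {k : ℕ} (w : Module.Basis (Fin k) ℝ (E k)) :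
    ∃ C : ℝ, 0 < C ∧ ∀ (x : E k) i, |w.repr x i| ≤ C * ‖x‖ := by
  let T : E k →L[ℝ] (Fin k → ℝ) := w.equivFun.toLinearMap.toContinuousLinearMap
  refine ⟨‖T‖ + 1, by positivity, fun x i => ?_⟩
  calc |w.repr x i| = ‖T x i‖ := rfl
    _ ≤ ‖T x‖ := norm_le_pi_norm _ _
    _ ≤ ‖T‖ * ‖x‖ := T.le_opNorm x
    _ ≤ (‖T‖ + 1) * ‖x‖ := by nlinarith [norm_nonneg x]

theorem repr_latticePoint {k : ℕ} (w : Module.Basis (Fin k) ℝ (E k)) (m : Fin k → ℤ) (i : Fin k) :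
    w.repr (∑ i, (m i : ℝ) • w i) i = m i := by
  simp [Finsupp.single_apply]

theorem uniformlyDiscrete_latticePoints {k : ℕ} (w : Module.Basis (Fin k) ℝ (E k)) :
    UniformlyDiscrete (latticePoints w) := by
  obtain ⟨C, hC0, hC⟩ := exists_abs_repr_le w
  refine ⟨1 / (2 * C), by positivity, ?_⟩
  rintro _ ⟨m, rfl⟩ _ ⟨m', rfl⟩ hne
  obtain ⟨i, hi⟩ : ∃ i, m i ≠ m' i := by
    by_contra! h
    exact hne (by simp [h])
  have h1 := hC ((∑ i, (m i : ℝ) • w i) - ∑ i, (m' i : ℝ) • w i) i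
  rw [map_sub, Finsupp.sub_apply, repr_latticePoint, repr_latticePoint, ← dist_eq_norm] at h1
  have h2 : (1 : ℝ) ≤ |(m i : ℝ) - m' i| := by
    have : 1 ≤ |m i - m' i| := Int.one_le_abs (sub_ne_zero.2 hi)
    exact_mod_cast this
  have h3 : 1 / C ≤ dist (∑ i, (m i : ℝ) • w i) (∑ i, (m' i : ℝ) • w i) := by
    rw [div_le_iff₀ hC0]
    linarith
  refine lt_of_lt_of_le ?_ h3
  exact one_div_lt_one_div_of_lt hC0 (by linarith)

/-- The samples form a full lattice: `w` across the lines and equal spacing along them. Its dual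
points outside the slice hyperplane are too long to violate admissibility. -/
theorem nyquistCondition_of_admissible {n : ℕ} {Ω : Set (E (n + 1))}
    (hbdd : Bornology.IsBounded Ω) (hconv : Convex ℝ Ω) (hsymm : ∀ x ∈ Ω, -x ∈ Ω)
    (U : E (n + 1) ≃ₗᵢ[ℝ] E (n + 1)) (w : Module.Basis (Fin n) ℝ (E n))
    (h : Admissible (slice Ω U) w) : NyquistCondition Ω (rotatedLineSet U w) := by
  obtain ⟨R, hR0, hR⟩ := hbdd.exists_pos_norm_le
  -- Spacing 1/R makes a nonzero dual coordinate along the lines at least 2πR, while `l/2 ∈ Ω`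
  -- forces it to be at most 2R.
  set τ : ℝ := 1 / R with hτ
  have hτ0 : 0 < τ := by positivity
  obtain ⟨v, hv⟩ := exists_basis_snoc U w hτ0.ne'
  refine ⟨latticePoints v, uniformlyDiscrete_latticePoints v, ?_, ?_⟩
  · rintro _ ⟨m, rfl⟩
    rw [rotatedLineSet_eq]
    refine ⟨_, ⟨fun i => m i.castSucc, rfl⟩, m (Fin.last n) * τ, ?_⟩
    simp only [Fin.sum_univ_castSucc, hv]
    simp only [Fin.snoc_castSucc, Fin.snoc_last, ← map_smul, ← map_sum, ← map_add]
    congr 1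
    ext1
    · simp [Prod.fst_sum]
    · simp [Prod.snd_sum]
  · refine determines_of_admissible hbdd hconv hsymm ?_
    intro l hl hint hmem
    obtain ⟨⟨s, t⟩, rfl⟩ := place_surjective U l
    have ht : t = 0 := by
      obtain ⟨j, hj⟩ := hint (Fin.last n)
      rw [hv, Fin.snoc_last, inner_place, inner_zero_right, zero_add] at hj
      have hn : ‖place U (s, t)‖ ≤ 2 * R := by
        have := hR _ (interior_subset hmem)
        rw [norm_smul] at this
        norm_num at this
        linarith
      have ht' : |t| ≤ 2 * R := by
        refine le_trans (abs_le_of_sq_le_sq' ?_ (norm_nonneg _) |> abs_le.2) hn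
        rw [norm_place_sq]
        nlinarith [sq_nonneg ‖s‖]
      by_contra ht0
      have hj0 : j ≠ 0 := by
        rintro rfl
        simp [ht0, hτ0.ne'] at hj
      have h1 : (1 : ℝ) ≤ |(j : ℝ)| := by exact_mod_cast Int.one_le_abs hj0
      have h2 : |t| = 2 * Real.pi * |(j : ℝ)| * R := by
        have : t = 2 * Real.pi * j * R := by
          simp only at hj
          rw [← hj, hτ]
          field_simp
        rw [this, abs_mul, abs_mul, abs_of_pos hR0, abs_of_pos (by positivity : 0 < 2 * Real.pi)]
      have h3 : 2 * Real.pi * R ≤ 2 * Real.pi * |(j : ℝ)| * R := by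
        have : 0 < 2 * Real.pi * R := by positivity
        nlinarith
      nlinarith [Real.pi_gt_three]
    subst ht
    refine h s ?_ (fun i => ?_) ?_
    · rintro rfl
      exact hl (map_zero _)
    · obtain ⟨j, hj⟩ := hint i.castSucc
      refine ⟨j, ?_⟩
      rw [← hj, hv, Fin.snoc_castSucc, inner_place]
      simp
    · apply mem_interior_slice (U := U)
      rw [← map_smul] at hmem
      simpa using hmem

/-- Every uniform set is a rotated line set. -/
theorem IsUniformSet.exists_eq_rotatedLineSet {n : ℕ} {Q : Set (ℝ → E (n + 1))}
    (hQ : IsUniformSet Q) :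
    ∃ (V : E (n + 1) ≃ₗᵢ[ℝ] E (n + 1)) (w : Module.Basis (Fin n) ℝ (E n)),
      Q = rotatedLineSet V w := by
  obtain ⟨v, hv, rfl⟩ := hQ
  set e : E (n + 1) := EuclideanSpace.single (Fin.last n) 1 with he
  have hnorm : ‖v (Fin.last n)‖ = ‖e‖ := by
    have : ‖v (Fin.last n)‖ ^ 2 = 1 := by
      rw [← real_inner_self_eq_norm_sq, hv]; simp
    rw [he, PiLp.norm_single, norm_one]
    nlinarith [norm_nonneg (v (Fin.last n))]
  -- The reflection in the hyperplane bisecting two vectors of equal length carries one to the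
  -- other.
  set V : E (n + 1) ≃ₗᵢ[ℝ] E (n + 1) := (ℝ ∙ (v (Fin.last n) - e))ᗮ.reflection with hV
  have hVv : V (v (Fin.last n)) = e := Submodule.reflection_sub hnorm
  have hlast : place V (0, 1) = v (Fin.last n) := by
    rw [place_zero_left, ← he, ← hVv, LinearIsometryEquiv.symm_apply_apply]
  have hex : ∀ i : Fin n, ∃ s : E n, place V (s, 0) = v i.castSucc := by
    intro i
    obtain ⟨⟨s, t⟩, hst⟩ := place_surjective V (v i.castSucc)
    have := hv i.castSucc
    rw [← hst, ← hlast, inner_place, if_neg (Fin.castSucc_ne_last i)] at this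
    simp at this
    exact ⟨s, by rw [← hst, this]⟩
  choose w hw using hex
  have hli : LinearIndependent ℝ w := by
    apply LinearIndependent.of_comp ((place V).comp (LinearMap.inl ℝ (E n) ℝ))
    have e1 : (⇑((place V).comp (LinearMap.inl ℝ (E n) ℝ)) ∘ w)
        = fun i : Fin n => v i.castSucc := by
      funext i
      exact hw i
    rw [e1]
    exact v.linearIndependent.comp _ (Fin.castSucc_injective n)
  refine ⟨V, Module.Basis.mk hli (hli.span_eq_top_of_card_eq_finrank' (by simp)).ge, ?_⟩
  rw [Module.Basis.coe_mk, rotatedLineSet]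
  congr 1
  funext i
  refine Fin.lastCases ?_ (fun j => ?_) i
  · rw [Fin.snoc_last, ← place_zero_left, hlast]
  · rw [Fin.snoc_castSucc, ← place_zero_right, hw]

/-! ### Sampling density and path density as reciprocal cell volumes. -/

theorem measurePreserving_place {n : ℕ} (U : E (n + 1) ≃ₗᵢ[ℝ] E (n + 1)) :
    MeasurePreserving (place U) (volume.prod volume) volume := by
  have h1 : MeasurePreserving (Prod.map (WithLp.ofLp : E n → Fin n → ℝ) (id : ℝ → ℝ))
      (volume.prod volume) (volume.prod volume) :=
    (PiLp.volume_preserving_ofLp (Fin n)).prod (MeasurePreserving.id volume)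
  have h2 : MeasurePreserving (Prod.swap : (Fin n → ℝ) × ℝ → ℝ × (Fin n → ℝ))
      (volume.prod volume) (volume.prod volume) := Measure.measurePreserving_swap
  have h3 := (volume_preserving_piFinSuccAbove (fun _ : Fin (n + 1) => ℝ) (Fin.last n)).symm
  have h4 := PiLp.volume_preserving_toLp (Fin (n + 1))
  have h5 := U.symm.measurePreserving
  have h := h5.comp (h4.comp (h3.comp (h2.comp h1)))
  have e : (place U : E n × ℝ → E (n + 1)) = U.symm ∘ WithLp.toLp 2 ∘
      (MeasurableEquiv.piFinSuccAbove (fun _ : Fin (n + 1) => ℝ) (Fin.last n)).symm ∘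
      Prod.swap ∘ Prod.map WithLp.ofLp id := by
    funext p
    rw [← Prod.mk.eta (p := p), place_apply]
    simp only [Function.comp_apply, Prod.map_apply, id_eq, Prod.swap_prod_mk,
      MeasurableEquiv.piFinSuccAbove_symm_apply]
    rw [← Fin.insertNth_last']
    rfl
  rw [e]
  exact h

theorem latticePoint_injective {n : ℕ} (w : Module.Basis (Fin n) ℝ (E n)) :
    Function.Injective fun m : Fin n → ℤ => ∑ i, (m i : ℝ) • w i := by
  intro m m' h
  funext i
  have := congrArg (fun x => w.repr x i) h
  simpa [Finsupp.single_apply] using this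

/-- `ZSpan.floor` is constant on each translate of the fundamental domain, so the right side
integrates a step function. It turns lattice sums into integrals comparable with ball volumes. -/
theorem tsum_lattice_mul_volume {n : ℕ} (w : Module.Basis (Fin n) ℝ (E n)) (G : E n → ℝ≥0∞) :
    (∑' m : Fin n → ℤ, G (∑ i, (m i : ℝ) • w i)) * volume (ZSpan.fundamentalDomain w)
      = ∫⁻ s, G (ZSpan.floor w s : E n) := by
  have hfd := ZSpan.isAddFundamentalDomain w (volume : Measure (E n))
  have hinv : VAddInvariantMeasure (Submodule.span ℤ (Set.range w)) (E n) volume :=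
    inferInstanceAs (VAddInvariantMeasure (Submodule.span ℤ (Set.range w)).toAddSubgroup (E n) volume)
  have hcount : Countable (Submodule.span ℤ (Set.range w)) :=
    (w.restrictScalars ℤ).equivFun.toEquiv.countable_iff.2 inferInstance
  rw [hfd.lintegral_eq_tsum'', ← ENNReal.tsum_mul_right,
    ← (w.restrictScalars ℤ).equivFun.symm.toEquiv.tsum_eq]
  refine tsum_congr fun m => ?_
  set g := (w.restrictScalars ℤ).equivFun.symm.toEquiv m with hg
  have hgm : (g : E n) = ∑ i, (m i : ℝ) • w i := by
    rw [hg]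
    simp [Module.Basis.equivFun_symm_apply, Int.cast_smul_eq_zsmul]
  have e : ∫⁻ x in ZSpan.fundamentalDomain w, G (ZSpan.floor w (g +ᵥ x) : E n)
      = ∫⁻ x in ZSpan.fundamentalDomain w, G (∑ i, (m i : ℝ) • w i) := by
    refine setLIntegral_congr_fun (ZSpan.fundamentalDomain_measurableSet w) fun x hx => ?_
    have h1 : ZSpan.fract w ((g : E n) + x) = x := by
      rw [ZSpan.fract_zSpan_add _ _ g.2, ZSpan.fract_eq_self.2 hx]
    rw [ZSpan.fract_apply] at h1
    have h2 : (ZSpan.floor w ((g : E n) + x) : E n) = g := by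
      rw [sub_eq_iff_eq_add, add_comm x] at h1
      exact (add_right_cancel h1).symm
    simp only [← hgm]
    rw [← h2]
    rfl
  rw [e, setLIntegral_const]

theorem norm_sub_floor_le {n : ℕ} (w : Module.Basis (Fin n) ℝ (E n)) (s : E n) :
    ‖s - ZSpan.floor w s‖ ≤ ∑ i, ‖w i‖ := ZSpan.norm_fract_le w s

/-- Sandwiching a count times a cell volume between volumes of balls gives the density. -/
theorem tendsto_div_volume_closedBall {k : ℕ} {X : ℝ → ℝ≥0∞} {c : ℝ≥0∞} (hc0 : c ≠ 0)
    (hc : c ≠ ∞) {D : ℝ}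
    (hle : ∀ a, X a * c ≤ volume (Metric.closedBall (0 : E k) (a + D)))
    (hge : ∀ a, volume (Metric.closedBall (0 : E k) (a - D)) ≤ X a * c) :
    Tendsto (fun a => X a / volume (Metric.closedBall (0 : E k) a)) atTop (𝓝 c⁻¹) := by
  have hball : ∀ a : ℝ, 0 < a → volume (Metric.closedBall (0 : E k) a) ≠ 0 := fun a ha =>
    (Metric.measure_closedBall_pos volume _ ha).ne'
  have hball' : ∀ a : ℝ, volume (Metric.closedBall (0 : E k) a) ≠ ∞ := fun a =>
    measure_closedBall_lt_top.ne
  have ratio : ∀ D : ℝ, Tendsto (fun a => volume (Metric.closedBall (0 : E k) (a + D)) /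
      volume (Metric.closedBall (0 : E k) a)) atTop (𝓝 1) := by
    intro D
    have h1 : Tendsto (fun a : ℝ => ENNReal.ofReal ((1 + D / a) ^ k)) atTop (𝓝 1) := by
      have : Tendsto (fun a : ℝ => (1 + D / a) ^ k) atTop (𝓝 ((1 + 0) ^ k)) :=
        ((tendsto_const_nhds.div_atTop tendsto_id).const_add 1).pow k
      simpa using ENNReal.tendsto_ofReal this
    refine h1.congr' ?_
    -- The ratio is also needed for -D, so `a` must be large enough for the radius `a + D` to be
    -- nonnegative.
    filter_upwards [eventually_gt_atTop (max 0 (-D))] with a ha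
    have ha0 : 0 < a := (le_max_left _ _).trans_lt ha
    have haD : 0 ≤ 1 + D / a := by
      have : -D < a := (le_max_right _ _).trans_lt ha
      rw [show 1 + D / a = (a + D) / a by field_simp]
      apply div_nonneg _ ha0.le
      linarith
    have e : a + D = (1 + D / a) * a := by field_simp
    rw [e, Measure.addHaar_closedBall_mul volume (0 : E k) haD ha0.le,
      ENNReal.mul_div_cancel_right (hball a ha0) (hball' a), finrank_euclideanSpace,
      Fintype.card_fin]
  have lim : ∀ D : ℝ, Tendsto (fun a => volume (Metric.closedBall (0 : E k) (a + D)) /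
      volume (Metric.closedBall (0 : E k) a) * c⁻¹) atTop (𝓝 c⁻¹) := by
    intro D
    simpa using ENNReal.Tendsto.mul_const (ratio D) (Or.inl one_ne_zero) (b := c⁻¹)
  refine tendsto_of_tendsto_of_tendsto_of_le_of_le (lim (-D)) (lim D) ?_ ?_
  · intro a
    calc _ ≤ X a * c / volume (Metric.closedBall (0 : E k) a) * c⁻¹ := by
          exact mul_le_mul' (ENNReal.div_le_div_right (hge a) _) le_rfl
      _ = X a / volume (Metric.closedBall (0 : E k) a) := by
          rw [div_eq_mul_inv, div_eq_mul_inv, mul_right_comm, mul_assoc (X a), ENNReal.mul_inv_cancel hc0 hc, mul_one]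
  · intro a
    calc X a / volume (Metric.closedBall (0 : E k) a)
        = X a * c / volume (Metric.closedBall (0 : E k) a) * c⁻¹ := by
          rw [div_eq_mul_inv, div_eq_mul_inv, mul_right_comm, mul_assoc (X a), ENNReal.mul_inv_cancel hc0 hc, mul_one]
      _ ≤ _ := mul_le_mul' (ENNReal.div_le_div_right (hle a) _) le_rfl

theorem volume_fundamentalDomain_ne_top {n : ℕ} (w : Module.Basis (Fin n) ℝ (E n)) :
    volume (ZSpan.fundamentalDomain w) ≠ ∞ :=
  (ZSpan.fundamentalDomain_isBounded w).measure_lt_top.ne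

/-- Rounding to the lattice moves a point by at most `∑ i, ‖w i‖`, so count times cell volume lies
between the volumes of two balls whose radii differ from `a` by that constant. -/
theorem samplingDensity_latticePoints {n : ℕ} (w : Module.Basis (Fin n) ℝ (E n)) :
    samplingDensity (latticePoints w) = (volume (ZSpan.fundamentalDomain w))⁻¹ := by
  refine Tendsto.limsup_eq ?_
  have hcount : ∀ a : ℝ, (((latticePoints w ∩ Metric.closedBall 0 a).encard : ℝ≥0∞))
      * volume (ZSpan.fundamentalDomain w)
      = ∫⁻ s, (Metric.closedBall (0 : E n) a).indicator 1 (ZSpan.floor w s : E n) := by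
    intro a
    rw [← tsum_lattice_mul_volume, ← tsum_range
      (f := fun x => (Metric.closedBall (0 : E n) a).indicator (1 : E n → ℝ≥0∞) x)
      (latticePoint_injective w), tsum_subtype, ← ENNReal.tsum_set_one,
      tsum_subtype _ (fun _ => (1 : ℝ≥0∞)), Set.indicator_indicator]
    rfl
  have hball : ∀ a : ℝ, volume (Metric.closedBall (0 : E n) a)
      = ∫⁻ s, (Metric.closedBall (0 : E n) a).indicator 1 s := fun a =>
    (lintegral_indicator_one Metric.isClosed_closedBall.measurableSet).symm
  have hD := norm_sub_floor_le w
  refine tendsto_div_volume_closedBall (D := ∑ i, ‖w i‖)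
    (ZSpan.measure_fundamentalDomain_ne_zero w) (volume_fundamentalDomain_ne_top w) ?_ ?_
  · intro a
    rw [hcount, hball]
    refine lintegral_mono fun s => ?_
    by_cases hs : (ZSpan.floor w s : E n) ∈ Metric.closedBall (0 : E n) a
    · rw [Set.indicator_of_mem hs, Set.indicator_of_mem]
      · rfl
      rw [mem_closedBall_zero_iff] at hs ⊢
      have : s = ZSpan.floor w s + (s - ZSpan.floor w s) := by abel
      rw [this]
      exact (norm_add_le _ _).trans (add_le_add hs (hD s))
    · rw [Set.indicator_of_notMem hs]
      exact zero_le
  · intro a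
    rw [hcount, hball]
    refine lintegral_mono fun s => ?_
    by_cases hs : s ∈ Metric.closedBall (0 : E n) (a - ∑ i, ‖w i‖)
    · rw [Set.indicator_of_mem hs, Set.indicator_of_mem]
      · rfl
      rw [mem_closedBall_zero_iff] at hs ⊢
      have : (ZSpan.floor w s : E n) = s - (s - ZSpan.floor w s) := by abel
      rw [this]
      refine (norm_sub_le _ _).trans ?_
      linarith [hD s]
    · rw [Set.indicator_of_notMem hs]
      exact zero_le

theorem lengthInBall_rotatedLineSet {n : ℕ} (U : E (n + 1) ≃ₗᵢ[ℝ] E (n + 1))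
    (w : Module.Basis (Fin n) ℝ (E n)) (a : ℝ) (x : E (n + 1)) :
    lengthInBall (rotatedLineSet U w) a x
      = ∑' m : Fin n → ℤ, volume {t : ℝ | ‖place U (∑ i, (m i : ℝ) • w i, t) - x‖ ≤ a} := by
  have hinj : Function.Injective fun (m : Fin n → ℤ) (t : ℝ) =>
      place U (∑ i, (m i : ℝ) • w i, t) := by
    intro m m' h
    have := place_injective U (congrFun h 0)
    exact latticePoint_injective w (Prod.ext_iff.1 this).1
  have hderiv : ∀ (s : E n) (t : ℝ),
      HasDerivAt (fun t => place U (s, t)) (place U (0, 1)) t := by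
    intro s t
    have h : HasDerivAt (fun t : ℝ => place U (s, 0) + t • place U (0, 1))
        ((1 : ℝ) • place U (0, 1)) t :=
      ((hasDerivAt_id t).smul_const _).const_add _
    rw [one_smul] at h
    have e : (fun t : ℝ => place U (s, t))
        = fun t => place U (s, 0) + t • place U (0, 1) := by
      funext r
      rw [← map_smul, ← map_add]
      simp
    rwa [e]
  have hnorm : ‖place U (0, 1)‖ₑ = 1 := by
    rw [place_zero_left, enorm_eq_nnnorm]
    simp
  rw [lengthInBall, rotatedLineSet_eq, tsum_range (f := fun p : ℝ → E (n + 1) =>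
    ∫⁻ t in {t : ℝ | ‖p t - x‖ ≤ a}, ‖deriv p t‖ₑ) hinj]
  refine tsum_congr fun m => ?_
  simp only [(hderiv _ _).deriv, hnorm, lintegral_one, Measure.restrict_apply_univ]

/-- Chord lengths integrated over all base points give the ball volume by Fubini, whatever the
centre. Rounding base points to the lattice costs a constant in the radius, uniformly in the centre,
so the supremum does no harm. -/
theorem pathDensity_rotatedLineSet {n : ℕ} (U : E (n + 1) ≃ₗᵢ[ℝ] E (n + 1))
    (w : Module.Basis (Fin n) ℝ (E n)) :
    pathDensity (rotatedLineSet U w) = (volume (ZSpan.fundamentalDomain w))⁻¹ := by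
  refine Tendsto.limsup_eq ?_
  have hD := norm_sub_floor_le w
  have hmul : ∀ a x, lengthInBall (rotatedLineSet U w) a x * volume (ZSpan.fundamentalDomain w)
      = ∫⁻ s, volume {t : ℝ | ‖place U ((ZSpan.floor w s : E n), t) - x‖ ≤ a} := by
    intro a x
    rw [lengthInBall_rotatedLineSet]
    exact tsum_lattice_mul_volume w fun p => volume {t : ℝ | ‖place U (p, t) - x‖ ≤ a}
  have hball : ∀ a x, ∫⁻ s, volume {t : ℝ | ‖place U (s, t) - x‖ ≤ a}
      = volume (Metric.closedBall (0 : E (n + 1)) a) := by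
    intro a x
    rw [← Measure.addHaar_closedBall_center volume x,
      ← (measurePreserving_place U).measure_preimage
        Metric.isClosed_closedBall.measurableSet.nullMeasurableSet, Measure.prod_apply
        (Metric.isClosed_closedBall.measurableSet.preimage (continuous_place U).measurable)]
    refine lintegral_congr fun s => ?_
    congr 1
  have hsplit : ∀ (s : E n) (t : ℝ), ‖place U ((ZSpan.floor w s : E n), t) - place U (s, t)‖
      ≤ ∑ i, ‖w i‖ := by
    intro s t
    rw [← map_sub, Prod.mk_sub_mk, sub_self, norm_place_zero_right, norm_sub_rev]
    exact hD s
  refine tendsto_div_volume_closedBall (D := ∑ i, ‖w i‖)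
    (ZSpan.measure_fundamentalDomain_ne_zero w) (volume_fundamentalDomain_ne_top w) ?_ ?_
  · intro a
    rw [ENNReal.iSup_mul]
    refine iSup_le fun x => ?_
    rw [hmul, ← hball _ x]
    refine lintegral_mono fun s => measure_mono fun t ht => ?_
    change ‖place U (s, t) - x‖ ≤ _
    have e : place U (s, t) - x = (place U ((ZSpan.floor w s : E n), t) - x)
      - (place U ((ZSpan.floor w s : E n), t) - place U (s, t)) := by abel
    rw [e]
    exact (norm_sub_le _ _).trans (add_le_add ht (hsplit s t))
  · intro a
    refine le_trans ?_ (mul_le_mul_left (le_iSup (fun x => lengthInBall (rotatedLineSet U w) a x) 0) _)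
    rw [hmul, ← hball _ 0]
    refine lintegral_mono fun s => measure_mono fun t ht => ?_
    change ‖place U (s, t) - 0‖ ≤ _ at ht
    change ‖place U ((ZSpan.floor w s : E n), t) - 0‖ ≤ a
    have e : place U ((ZSpan.floor w s : E n), t) - 0 = (place U (s, t) - 0)
      + (place U ((ZSpan.floor w s : E n), t) - place U (s, t)) := by abel
    rw [e]
    refine (norm_add_le _ _).trans ?_
    linarith [hsplit s t]

theorem isTrajectorySet_rotatedLineSet {n : ℕ} (U : E (n + 1) ≃ₗᵢ[ℝ] E (n + 1))
    (w : Fin n → E n) : IsTrajectorySet (rotatedLineSet U w) := by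
  rw [rotatedLineSet_eq]
  refine ⟨Set.countable_range _, ?_⟩
  rintro _ ⟨m, rfl⟩
  have h : ∀ s : E n, Differentiable ℝ fun t : ℝ => place U (s, t) := by
    intro s
    have : (fun t : ℝ => place U (s, t))
        = fun t => (place U).toContinuousLinearMap (s, t) := rfl
    rw [this]
    fun_prop
  exact h _

/-! ### Curves through finitely many chords -/

/-- Some curve of length at most `L` from `p` to `q` contains `S`. -/
def Covers {V : Type*} [PseudoEMetricSpace V] (S : Set V) (p q : V) (L : ℝ≥0∞) : Prop :=
  ∃ c : ℝ → V, ContinuousOn c (Set.Icc 0 1) ∧ c 0 = p ∧ c 1 = q ∧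
    eVariationOn c (Set.Icc 0 1) ≤ L ∧ S ⊆ c '' Set.Icc 0 1

theorem covers_segment {V : Type*} [NormedAddCommGroup V] [NormedSpace ℝ V] (p q : V) :
    Covers (segment ℝ p q) p q (ENNReal.ofReal ‖p - q‖) := by
  refine ⟨AffineMap.lineMap p q, ?_, by simp, by simp, ?_, ?_⟩
  · exact (AffineMap.lineMap_continuous).continuousOn
  · have hl : LipschitzWith (nndist p q) (AffineMap.lineMap p q : ℝ → V) :=
      lipschitzWith_lineMap p q
    have h1 := (hl.lipschitzOnWith (s := Set.univ)).comp_eVariationOn_le (g := (id : ℝ → ℝ))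
      (s := Set.Icc 0 1) (fun _ _ => Set.mem_univ _)
    have h2 : eVariationOn (id : ℝ → ℝ) (Set.Icc 0 1) ≤ ENNReal.ofReal (1 - 0) := by
      simp
    refine h1.trans ((mul_le_mul' le_rfl h2).trans ?_)
    rw [sub_zero, ENNReal.ofReal_one, mul_one, ← dist_eq_norm, ← coe_nndist, ENNReal.ofReal_coe_nnreal]
  · rw [segment_eq_image_lineMap]

theorem Covers.trans {V : Type*} [PseudoEMetricSpace V] {S T : Set V} {p q r : V} {L M : ℝ≥0∞}
    (h₁ : Covers S p q L) (h₂ : Covers T q r M) : Covers (S ∪ T) p r (L + M) := by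
  obtain ⟨c, hc, hc0, hc1, hcL, hS⟩ := h₁
  obtain ⟨d, hd, hd0, hd1, hdM, hT⟩ := h₂
  set g : ℝ → V := fun t => if t ≤ 1 / 2 then c (2 * t) else d (2 * t - 1) with hg
  have e1 : Set.EqOn g (c ∘ fun t => 2 * t) (Set.Icc 0 (1 / 2)) := by
    intro t ht
    simp only [hg, if_pos ht.2, Function.comp_apply]
  have e2 : Set.EqOn g (d ∘ fun t => 2 * t - 1) (Set.Icc (1 / 2) 1) := by
    intro t ht
    rcases ht.1.eq_or_lt with rfl | hlt
    · simp [hg, hc1, hd0]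
    · simp only [hg, if_neg (not_le.2 hlt), Function.comp_apply]
  have m1 : Set.MapsTo (fun t : ℝ => 2 * t) (Set.Icc 0 (1 / 2)) (Set.Icc 0 1) := by
    intro t ht
    constructor <;> linarith [ht.1, ht.2]
  have m2 : Set.MapsTo (fun t : ℝ => 2 * t - 1) (Set.Icc (1 / 2) 1) (Set.Icc 0 1) := by
    intro t ht
    constructor <;> linarith [ht.1, ht.2]
  have hu : Set.Icc (0 : ℝ) 1 = Set.Icc 0 (1 / 2) ∪ Set.Icc (1 / 2) 1 :=
    (Set.Icc_union_Icc_eq_Icc (by norm_num) (by norm_num)).symm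
  refine ⟨g, ?_, ?_, ?_, ?_, ?_⟩
  · rw [hu]
    refine ContinuousOn.union_of_isClosed ?_ ?_ isClosed_Icc isClosed_Icc
    · exact (hc.comp (by fun_prop) m1).congr e1
    · exact (hd.comp (by fun_prop) m2).congr e2
  · simp [hg, hc0]
  · norm_num [hg, hd1]
  · have h := eVariationOn.Icc_add_Icc g (s := Set.univ) (a := 0) (b := 1 / 2) (c := 1)
      (by norm_num) (by norm_num) (Set.mem_univ _)
    simp only [Set.univ_inter] at h
    rw [← h, eVariationOn.congr e1, eVariationOn.congr e2]
    refine add_le_add (le_trans ?_ hcL) (le_trans ?_ hdM)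
    · exact eVariationOn.comp_le_of_monotoneOn c _ (fun x _ y _ h => by linarith) m1
    · exact eVariationOn.comp_le_of_monotoneOn d _ (fun x _ y _ h => by linarith) m2
  · rintro x (hx | hx)
    · obtain ⟨t, ht, rfl⟩ := hS hx
      have ht' : t / 2 ∈ Set.Icc (0 : ℝ) (1 / 2) := by
        constructor <;> linarith [ht.1, ht.2]
      refine ⟨t / 2, hu ▸ Or.inl ht', ?_⟩
      rw [e1 ht']
      simp only [Function.comp_apply]
      congr 1
      ring
    · obtain ⟨t, ht, rfl⟩ := hT hx
      have ht' : (t + 1) / 2 ∈ Set.Icc (1 / 2 : ℝ) 1 := by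
        constructor <;> linarith [ht.1, ht.2]
      refine ⟨(t + 1) / 2, hu ▸ Or.inr ht', ?_⟩
      rw [e2 ht']
      simp only [Function.comp_apply]
      congr 1
      ring

theorem Covers.mono {V : Type*} [PseudoEMetricSpace V] {S T : Set V} {p q : V} {L M : ℝ≥0∞}
    (h : Covers S p q L) (hST : T ⊆ S) (hLM : L ≤ M) : Covers T p q M := by
  obtain ⟨c, hc, hc0, hc1, hcL, hS⟩ := h
  exact ⟨c, hc, hc0, hc1, hcL.trans hLM, hST.trans hS⟩

/-- The sign `σ` records the direction in which the chord is traversed. -/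
theorem place_mem_segment {n : ℕ} (U : E (n + 1) ≃ₗᵢ[ℝ] E (n + 1)) (s : E n) {t₀ h t σ : ℝ}
    (hσ : σ = 1 ∨ σ = -1) (ht : |t - t₀| ≤ h) :
    place U (s, t) ∈ segment ℝ (place U (s, t₀ + σ * h)) (place U (s, t₀ - σ * h)) := by
  have hm : t ∈ segment ℝ (t₀ + σ * h) (t₀ - σ * h) := by
    obtain ⟨h1, h2⟩ := abs_le.1 ht
    rcases hσ with rfl | rfl
    · rw [segment_symm, segment_eq_Icc (by linarith)]
      constructor <;> linarith
    · rw [segment_eq_Icc (by linarith)]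
      constructor <;> linarith
  obtain ⟨a, b, ha, hb, hab, hs⟩ := hm
  refine ⟨a, b, ha, hb, hab, ?_⟩
  rw [← map_smul, ← map_smul, ← map_add]
  congr 1
  ext1
  · simp [← add_smul, hab]
  · exact hs

/-- A curve running through chords of half-lengths `h i` one after the other. -/
theorem exists_covers_chords {n : ℕ} (U : E (n + 1) ≃ₗᵢ[ℝ] E (n + 1)) {ι : Type*} (s : ι → E n)
    (h : ι → ℝ) (hh : ∀ i, 0 ≤ h i) (t₀ κ : ℝ) (l : List ι) :
    ∀ (i : ι) (σ : ℝ), (σ = 1 ∨ σ = -1) →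
      List.IsChain (fun i j => ‖s i - s j‖ + |h i - h j| ≤ κ) (i :: l) →
      ∃ q, Covers {x | ∃ j ∈ i :: l, ∃ t, |t - t₀| ≤ h j ∧ place U (s j, t) = x}
        (place U (s i, t₀ + σ * h i)) q
        (((i :: l).map fun j => ENNReal.ofReal (2 * h j)).sum + l.length * ENNReal.ofReal κ) := by
  have hseg : ∀ (i : ι) (σ : ℝ), (σ = 1 ∨ σ = -1) →
      ‖place U (s i, t₀ + σ * h i) - place U (s i, t₀ - σ * h i)‖ ≤ 2 * h i := by
    intro i σ hσ
    rw [← map_sub]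
    refine (norm_place_le _ _).trans ?_
    simp only [Prod.mk_sub_mk, sub_self, norm_zero, zero_add]
    have : t₀ + σ * h i - (t₀ - σ * h i) = σ * (2 * h i) := by ring
    rw [this, abs_mul]
    rcases hσ with rfl | rfl <;> simp [abs_of_nonneg (hh i)]
  induction l with
  | nil =>
    intro i σ hσ _
    refine ⟨_, (covers_segment (place U (s i, t₀ + σ * h i))
      (place U (s i, t₀ - σ * h i))).mono ?_ ?_⟩
    · rintro _ ⟨j, hj, t, ht, rfl⟩
      rw [List.mem_singleton] at hj
      subst hj
      exact place_mem_segment U _ hσ ht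
    · simpa using ENNReal.ofReal_le_ofReal (hseg i σ hσ)
  | cons k l ih =>
    intro i σ hσ hch
    rw [List.isChain_cons_cons] at hch
    have hσ' : -σ = 1 ∨ -σ = -1 := by
      rcases hσ with rfl | rfl <;> simp
    -- Consecutive chords run in opposite directions, so the link joins neighbouring ends and costs
    -- at most the gap between the lines plus the difference of half-lengths.
    obtain ⟨q, hq⟩ := ih k (-σ) hσ' hch.2
    have hc1 := covers_segment (place U (s i, t₀ + σ * h i)) (place U (s i, t₀ - σ * h i))
    have hc2 := covers_segment (place U (s i, t₀ - σ * h i)) (place U (s k, t₀ + -σ * h k))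
    refine ⟨q, ((hc1.trans hc2).trans hq).mono ?_ ?_⟩
    · rintro _ ⟨j, hj, t, ht, rfl⟩
      rcases List.mem_cons.1 hj with rfl | hj
      · exact Or.inl (Or.inl (place_mem_segment U _ hσ ht))
      · exact Or.inr ⟨j, hj, t, ht, rfl⟩
    · have hstep : ‖place U (s i, t₀ - σ * h i) - place U (s k, t₀ + -σ * h k)‖ ≤ κ := by
        rw [← map_sub]
        refine (norm_place_le _ _).trans (le_trans (le_of_eq ?_) hch.1)
        simp only [Prod.mk_sub_mk]
        congr 1
        have : t₀ - σ * h i - (t₀ + -σ * h k) = -σ * (h i - h k) := by ring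
        rw [this, abs_mul]
        rcases hσ with rfl | rfl <;> simp
      have a1 := ENNReal.ofReal_le_ofReal (hseg i σ hσ)
      have a2 := ENNReal.ofReal_le_ofReal hstep
      calc _ ≤ ENNReal.ofReal (2 * h i) + ENNReal.ofReal κ +
            (((k :: l).map fun j => ENNReal.ofReal (2 * h j)).sum
              + l.length * ENNReal.ofReal κ) := by gcongr
        _ = _ := by
          rw [List.map_cons (a := i), List.sum_cons, List.length_cons]
          push_cast
          ring

/-! ### Snake enumeration of a box -/

/-- Layers are listed alternately forwards and backwards, so the last entry of one sits above the
first entry of the next. The clause on `head?` is what lets the induction glue layers; symmetry of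
`R` allows the reversal. -/
theorem exists_snake_step {α β : Type*} {R : α → α → Prop} {S : β → β → Prop}
    (hR : ∀ a b, R a b → R b a) (f : ℤ → α → β) (hf : ∀ j j' a a', f j a = f j' a' → j = j' ∧ a = a')
    (h1 : ∀ j a b, R a b → S (f j a) (f j b)) (h2 : ∀ j a, S (f j a) (f (j + 1) a)) (N : ℕ) :
    ∀ (l : List α) (j₀ : ℤ), l.IsChain R → l.Nodup →
      ∃ L : List β, L.IsChain S ∧ L.Nodup ∧
        (∀ b, b ∈ L ↔ ∃ j a, j₀ ≤ j ∧ j < j₀ + N ∧ a ∈ l ∧ b = f j a) ∧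
        L.length = N * l.length ∧ ∀ y ∈ L.head?, ∃ a ∈ l.head?, y = f j₀ a := by
  induction N with
  | zero =>
    intro l j₀ _ _
    refine ⟨[], by simp, by simp, ?_, by simp, by simp⟩
    intro b
    simp only [List.not_mem_nil, false_iff]
    rintro ⟨j, a, h, h', -⟩
    simp at h'
    omega
  | succ N ih =>
    intro l j₀ hl hn
    obtain ⟨L, hL, hLn, hLm, hLl, hLh⟩ := ih l.reverse (j₀ + 1)
      (List.isChain_reverse.2 (hl.imp fun a b h => hR a b h)) (List.nodup_reverse.2 hn)
    refine ⟨l.map (f j₀) ++ L, ?_, ?_, ?_, ?_, ?_⟩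
    · rw [List.isChain_append]
      refine ⟨List.isChain_map_of_isChain _ (fun a b h => h1 j₀ a b h) hl, hL, ?_⟩
      intro x hx y hy
      obtain ⟨a, ha, rfl⟩ := hLh y hy
      rw [List.head?_reverse] at ha
      rw [List.getLast?_map] at hx
      rw [Option.mem_def.1 ha, Option.map_some, Option.mem_some_iff] at hx
      subst hx
      exact h2 j₀ a
    · rw [List.nodup_append]
      refine ⟨hn.map fun a b h => (hf _ _ _ _ h).2, hLn, ?_⟩
      intro x hx y hy hxy
      obtain ⟨a, -, rfl⟩ := List.mem_map.1 hx
      obtain ⟨j, a', hj, -, -, h⟩ := (hLm y).1 hy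
      have := (hf _ _ _ _ (hxy.trans h)).1
      omega
    · intro b
      rw [List.mem_append, hLm, List.mem_map]
      constructor
      · rintro (⟨a, ha, rfl⟩ | ⟨j, a, hj, hj', ha, rfl⟩)
        · exact ⟨j₀, a, le_rfl, by push_cast; omega, ha, rfl⟩
        · exact ⟨j, a, by omega, by push_cast; omega, List.mem_reverse.1 ha, rfl⟩
      · rintro ⟨j, a, hj, hj', ha, rfl⟩
        rcases hj.eq_or_lt with rfl | hlt
        · exact Or.inl ⟨a, ha, rfl⟩
        · exact Or.inr ⟨j, a, by omega, by push_cast at hj'; omega, List.mem_reverse.2 ha, rfl⟩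
    · rw [List.length_append, List.length_map, hLl, List.length_reverse]
      ring
    · intro y hy
      cases l with
      | nil =>
        have : L = [] := List.eq_nil_of_length_eq_zero (by simpa using hLl)
        simp [this] at hy
      | cons a l =>
        refine ⟨a, by simp, ?_⟩
        simpa using hy.symm

theorem exists_snake (n M : ℕ) :
    ∃ l : List (Fin n → ℤ), l.IsChain (fun m m' => ∀ i, |m i - m' i| ≤ 1) ∧ l.Nodup ∧
      (∀ m, m ∈ l ↔ ∀ i, |m i| ≤ M) ∧ l.length = (2 * M + 1) ^ n := by
  induction n with
  | zero =>
    refine ⟨[0], by simp, by simp, fun m => ?_, by simp⟩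
    simp [Subsingleton.elim m 0]
  | succ n ih =>
    obtain ⟨l, hl, hn, hm, hlen⟩ := ih
    obtain ⟨L, hL, hLn, hLm, hLl, -⟩ := exists_snake_step
      (R := fun m m' : Fin n → ℤ => ∀ i, |m i - m' i| ≤ 1)
      (S := fun m m' : Fin (n + 1) → ℤ => ∀ i, |m i - m' i| ≤ 1)
      (fun a b h i => by rw [abs_sub_comm]; exact h i)
      (fun j a => Fin.cons (α := fun _ => ℤ) j a)
      (fun j j' a a' h => Fin.cons_inj.1 h)
      (fun j a b h i => by
        refine Fin.cases ?_ (fun i => ?_) i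
        · simp
        · simpa using h i)
      (fun j a i => by
        refine Fin.cases ?_ (fun i => ?_) i <;> simp)
      -- One layer for each value of the first coordinate, from -M to M.
      (2 * M + 1) l (-M) hl hn
    refine ⟨L, hL, hLn, fun m => ?_, ?_⟩
    · rw [hLm]
      constructor
      · rintro ⟨j, a, hj, hj', ha, rfl⟩ i
        refine Fin.cases ?_ (fun i => ?_) i
        · rw [Fin.cons_zero, abs_le]
          push_cast at hj'
          omega
        · rw [Fin.cons_succ]
          exact (hm a).1 ha i
      · intro h
        have h0 := abs_le.1 (h 0)
        refine ⟨m 0, Fin.tail m, by omega, by push_cast; omega, (hm _).2 fun i => h i.succ, ?_⟩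
        exact (Fin.cons_self_tail m).symm
    · rw [hLl, hlen, pow_succ, mul_comm]

/-! ### Link lengths and non-degeneracy. -/

/-- Hölder continuity with exponent 1/2, valid also for negative arguments, where `√` is 0. Lines
that miss the ball can thus be treated as chords of half-length 0. -/
theorem abs_sqrt_sub_sqrt_le (a b : ℝ) : |√a - √b| ≤ √|a - b| := by
  have key : ∀ a b : ℝ, √a ≤ √b + √|a - b| := by
    intro a b
    rw [Real.sqrt_le_left (by positivity)]
    have h1 : b ≤ √b ^ 2 := by
      rcases le_total 0 b with h | h
      · rw [Real.sq_sqrt h]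
      · exact h.trans (sq_nonneg _)
    have h2 : √|a - b| ^ 2 = |a - b| := Real.sq_sqrt (abs_nonneg _)
    nlinarith [le_abs_self (a - b), Real.sqrt_nonneg b, Real.sqrt_nonneg |a - b|,
      mul_nonneg (Real.sqrt_nonneg b) (Real.sqrt_nonneg |a - b|)]
  rw [abs_le]
  have h1 := key a b
  have h2 := key b a
  rw [abs_sub_comm b a] at h2
  constructor <;> linarith

theorem norm_latticePoint_sub_le {n : ℕ} (w : Fin n → E n) {m m' : Fin n → ℤ} {B : ℝ}
    (h : ∀ i, |(m i : ℝ) - m' i| ≤ B) :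
    ‖∑ i, (m i : ℝ) • w i - ∑ i, (m' i : ℝ) • w i‖ ≤ B * ∑ i, ‖w i‖ := by
  rw [← Finset.sum_sub_distrib, Finset.mul_sum]
  refine norm_sum_le_of_le _ fun i _ => ?_
  rw [← sub_smul, norm_smul]
  exact mul_le_mul_of_nonneg_right (h i) (norm_nonneg _)

/-- The length needed to link up all chords of a ball of radius `a`. -/
theorem exists_connecting_curve {n : ℕ} (U : E (n + 1) ≃ₗᵢ[ℝ] E (n + 1))
    (w : Module.Basis (Fin n) ℝ (E n)) {C : ℝ} (hC0 : 0 < C)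
    (hC : ∀ (x : E n) i, |w.repr x i| ≤ C * ‖x‖) (y : E n) (t₀ : ℝ) {a : ℝ} (ha : 0 < a) {M : ℕ}
    (hM : C * (a + ‖y‖) ≤ M) :
    ∃ p q, Covers {z | ∃ p ∈ rotatedLineSet U w, ∃ t, p t = z ∧ ‖p t - place U (y, t₀)‖ ≤ a} p q
      (lengthInBall (rotatedLineSet U w) a (place U (y, t₀)) +
        ENNReal.ofReal ((2 * M + 1) ^ n * (∑ i, ‖w i‖ +
          √((∑ i, ‖w i‖) * (2 * (M * ∑ i, ‖w i‖ + ‖y‖)))))) := by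
  set W := ∑ i, ‖w i‖ with hW
  have hW0 : 0 ≤ W := Finset.sum_nonneg fun i _ => norm_nonneg _
  -- Neighbours in the snake are at most `W` apart, and their squared distances to `y` differ by at
  -- most `W` times the sum of those distances; the square root bounds the change of half-length.
  set κ := W + √(W * (2 * (M * W + ‖y‖))) with hκ
  set s : (Fin n → ℤ) → E n := fun m => ∑ i, (m i : ℝ) • w i with hs
  set h : (Fin n → ℤ) → ℝ := fun m => √(a ^ 2 - ‖s m - y‖ ^ 2) with hh
  obtain ⟨l, hl, hn, hm, hlen⟩ := exists_snake n M
  have hball : ∀ m t, ‖place U (s m, t) - place U (y, t₀)‖ ≤ a ↔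
      ‖s m - y‖ ^ 2 + (t - t₀) ^ 2 ≤ a ^ 2 := by
    intro m t
    rw [← map_sub, ← sq_le_sq₀ (norm_nonneg _) ha.le, norm_place_sq]
    rfl
  have hnorm : ∀ m ∈ l, ‖s m - y‖ ≤ M * W + ‖y‖ := by
    intro m hml
    have h1 := norm_latticePoint_sub_le (w := w) (m := m) (m' := 0) (B := M) fun i => by
      have := (hm m).1 hml i
      simp only [Pi.zero_apply, Int.cast_zero, sub_zero]
      exact_mod_cast this
    simp only [Pi.zero_apply, Int.cast_zero, zero_smul, Finset.sum_const_zero, sub_zero] at h1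
    exact (norm_sub_le _ _).trans (by linarith)
  have hchain : l.IsChain (fun m m' => ‖s m - s m'‖ + |h m - h m'| ≤ κ) := by
    have hmem : l.IsChain (fun m m' => m ∈ l ∧ m' ∈ l) := by
      rw [List.isChain_iff_getElem]
      intro i hi
      exact ⟨List.getElem_mem _, List.getElem_mem _⟩
    refine (List.isChain_iff_getElem.2 fun i hi => ?_)
    have hstep := List.isChain_iff_getElem.1 hl i hi
    have hm1 : l[i] ∈ l := List.getElem_mem _
    have hm2 : l[i + 1] ∈ l := List.getElem_mem _
    generalize l[i] = m at hstep hm1 ⊢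
    generalize l[i + 1] = m' at hstep hm2 ⊢
    have h1 : ‖s m - s m'‖ ≤ W := by
      have := norm_latticePoint_sub_le (w := w) (m := m) (m' := m') (B := 1) fun i => by
        exact_mod_cast hstep i
      simpa using this
    refine add_le_add h1 ((abs_sqrt_sub_sqrt_le _ _).trans (Real.sqrt_le_sqrt ?_))
    have e : a ^ 2 - ‖s m - y‖ ^ 2 - (a ^ 2 - ‖s m' - y‖ ^ 2)
        = (‖s m' - y‖ - ‖s m - y‖) * (‖s m' - y‖ + ‖s m - y‖) := by ring
    rw [e, abs_mul, abs_of_nonneg (by positivity : 0 ≤ ‖s m' - y‖ + ‖s m - y‖)]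
    refine mul_le_mul ?_ ?_ (by positivity) hW0
    · refine (abs_norm_sub_norm_le _ _).trans (le_trans (le_of_eq ?_) h1)
      rw [sub_sub_sub_cancel_right, norm_sub_rev]
    · linarith [hnorm m hm1, hnorm m' hm2]
  have hne : l ≠ [] := by
    have : (0 : Fin n → ℤ) ∈ l := (hm 0).2 fun i => by simp
    exact List.ne_nil_of_mem this
  obtain ⟨m₀, l', rfl⟩ := List.exists_cons_of_ne_nil hne
  obtain ⟨q, hq⟩ := exists_covers_chords U s h (fun m => Real.sqrt_nonneg _) t₀ κ l' m₀ 1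
    (Or.inl rfl) hchain
  refine ⟨_, q, hq.mono ?_ ?_⟩
  · rintro z ⟨p, hp, t, rfl, hpt⟩
    rw [rotatedLineSet_eq] at hp
    obtain ⟨m, rfl⟩ := hp
    have hb := (hball m t).1 hpt
    refine ⟨m, (hm m).2 fun i => ?_, t, ?_, rfl⟩
    · have h1 : ‖s m - y‖ ≤ a := by
        rw [← sq_le_sq₀ (norm_nonneg _) ha.le]
        nlinarith [sq_nonneg (t - t₀)]
      have h2 : ‖s m‖ ≤ a + ‖y‖ := by
        have : s m = (s m - y) + y := by abel
        rw [this]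
        exact (norm_add_le _ _).trans (by linarith)
      have h3 : |(m i : ℝ)| ≤ M := by
        have := hC (s m) i
        rw [hs, repr_latticePoint] at this
        exact this.trans ((mul_le_mul_of_nonneg_left h2 hC0.le).trans hM)
      exact_mod_cast h3
    · apply Real.le_sqrt_of_sq_le
      rw [sq_abs]
      linarith
  · refine add_le_add ?_ ?_
    -- The snake visits no line twice, so the chords it runs through are charged once each to the
    -- length in the ball.
    · rw [lengthInBall_rotatedLineSet, ← List.sum_toFinset _ hn]
      refine (Finset.sum_le_sum fun m _ => ?_).trans (ENNReal.sum_le_tsum _)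
      rcases le_or_gt (a ^ 2 - ‖s m - y‖ ^ 2) 0 with hle | hpos
      · have : h m = 0 := Real.sqrt_eq_zero_of_nonpos hle
        simp [this]
      · have hsub : Set.Icc (t₀ - h m) (t₀ + h m)
            ⊆ {t : ℝ | ‖place U (s m, t) - place U (y, t₀)‖ ≤ a} := by
          intro t ht
          refine (hball m t).2 ?_
          have h1 : (t - t₀) ^ 2 ≤ h m ^ 2 := by
            apply sq_le_sq'
            · linarith [ht.1]
            · linarith [ht.2]
          rw [Real.sq_sqrt hpos.le] at h1
          linarith
        refine le_trans (le_of_eq ?_) (measure_mono hsub)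
        rw [Real.volume_Icc]
        congr 1
        ring
    · have h1 : ((l'.length : ℕ) : ℝ≥0∞) ≤ ENNReal.ofReal ((2 * M + 1) ^ n) := by
        rw [← ENNReal.ofReal_natCast]
        refine ENNReal.ofReal_le_ofReal ?_
        have : l'.length ≤ (2 * M + 1) ^ n := by
          rw [← hlen, List.length_cons]
          omega
        exact_mod_cast this
      rw [ENNReal.ofReal_mul (by positivity)]
      exact mul_le_mul' h1 le_rfl

/-- The box has side O(a), hence O(a^n) links of length O(√a), and a^n √a = o(a^(n+1)). -/
theorem isLittleO_connecting_length {n : ℕ} {C W X : ℝ} (hC : 0 < C) (hW : 0 ≤ W) (hX : 0 ≤ X) :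
    (fun a : ℝ => (2 * (⌈C * (a + X)⌉₊ : ℝ) + 1) ^ n *
      (W + √(W * (2 * (⌈C * (a + X)⌉₊ * W + X))))) =o[atTop] fun a : ℝ => a ^ (n + 1) := by
  have hM : ∀ a : ℝ, 1 ≤ a → (⌈C * (a + X)⌉₊ : ℝ) ≤ (C * (1 + X) + 1) * a := by
    intro a ha
    have h1 := (Nat.ceil_lt_add_one (a := C * (a + X)) (by positivity)).le
    nlinarith [mul_nonneg hC.le hX, mul_nonneg (mul_nonneg hC.le hX) (sub_nonneg.2 ha)]
  set c := C * (1 + X) + 1 with hc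
  have hc0 : 0 < c := by positivity
  have hO : (fun a : ℝ => (2 * (⌈C * (a + X)⌉₊ : ℝ) + 1) ^ n *
      (W + √(W * (2 * (⌈C * (a + X)⌉₊ * W + X))))) =O[atTop] fun a : ℝ => a ^ n * √a := by
    refine Asymptotics.IsBigO.of_bound
      ((2 * c + 1) ^ n * (W + √(W * (2 * (c * W + X))))) ?_
    filter_upwards [eventually_ge_atTop (1 : ℝ)] with a ha
    have h1 := hM a ha
    have ha0 : 0 ≤ a := by linarith
    rw [Real.norm_of_nonneg (by positivity), Real.norm_of_nonneg (by positivity)]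
    have hs1 : 1 ≤ √a := Real.one_le_sqrt.2 ha
    have e1 : (2 * (⌈C * (a + X)⌉₊ : ℝ) + 1) ^ n ≤ (2 * c + 1) ^ n * a ^ n := by
      rw [← mul_pow]
      refine pow_le_pow_left₀ (by positivity) ?_ n
      nlinarith
    have e2 : √(W * (2 * (⌈C * (a + X)⌉₊ * W + X))) ≤ √(W * (2 * (c * W + X))) * √a := by
      rw [← Real.sqrt_mul (by positivity)]
      refine Real.sqrt_le_sqrt ?_
      have : ⌈C * (a + X)⌉₊ * W + X ≤ (c * W + X) * a := by
        nlinarith [mul_le_mul_of_nonneg_right h1 hW, mul_nonneg hX (sub_nonneg.2 ha)]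
      have := mul_le_mul_of_nonneg_left this hW
      nlinarith
    have e3 : W ≤ W * √a := le_mul_of_one_le_right hW hs1
    calc _ ≤ (2 * c + 1) ^ n * a ^ n * (W * √a + √(W * (2 * (c * W + X))) * √a) := by
          gcongr
      _ = _ := by ring
  refine hO.trans_isLittleO ?_
  have h1 : (fun a : ℝ => √a) =o[atTop] fun a : ℝ => a := by
    have h2 : (fun _ : ℝ => (1 : ℝ)) =o[atTop] fun a : ℝ => √a := by
      rw [Asymptotics.isLittleO_const_left]
      right
      exact tendsto_norm_atTop_atTop.comp Real.tendsto_sqrt_atTop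
    have h3 := h2.mul_isBigO (Asymptotics.isBigO_refl (fun a : ℝ => √a) atTop)
    refine h3.congr' (by simp) ?_
    filter_upwards [eventually_ge_atTop 0] with a ha
    exact Real.mul_self_sqrt ha
  simpa only [pow_succ] using (Asymptotics.isBigO_refl (fun a : ℝ => a ^ n) atTop).mul_isLittleO h1

theorem nonDegenerate_rotatedLineSet {n : ℕ} (U : E (n + 1) ≃ₗᵢ[ℝ] E (n + 1))
    (w : Module.Basis (Fin n) ℝ (E n)) : NonDegenerate (rotatedLineSet U w) := by
  intro x
  obtain ⟨⟨y, t₀⟩, rfl⟩ := place_surjective U x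
  obtain ⟨C, hC0, hC⟩ := exists_abs_repr_le w
  refine ⟨_, isLittleO_connecting_length (n := n) (W := ∑ i, ‖w i‖) hC0
    (Finset.sum_nonneg fun i _ => norm_nonneg (w i)) (norm_nonneg y), fun a ha => ?_⟩
  obtain ⟨p, q, c, hc, -, -, hlen, hsub⟩ :=
    exists_connecting_curve U w hC0 hC y t₀ ha (Nat.le_ceil _)
  exact ⟨c, hc, hlen, fun p hp t ht => hsub ⟨p, hp, t, rfl, ht⟩⟩

/-! ### Scaling and approximation of the minimal sampling density. -/

open scoped Pointwise

theorem exists_scaled_basis {n : ℕ} (w : Module.Basis (Fin n) ℝ (E n)) {c : ℝ} (hc : 0 < c) :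
    ∃ w' : Module.Basis (Fin n) ℝ (E n), (∀ i, w' i = c • w i) ∧
      samplingDensity (latticePoints w')
        = (ENNReal.ofReal (c ^ n))⁻¹ * samplingDensity (latticePoints w) := by
  refine ⟨w.map (LinearEquiv.smulOfNeZero ℝ (E n) c hc.ne'), fun i => by simp, ?_⟩
  rw [samplingDensity_latticePoints, samplingDensity_latticePoints, ← ZSpan.map_fundamentalDomain]
  have e : (LinearEquiv.smulOfNeZero ℝ (E n) c hc.ne') '' ZSpan.fundamentalDomain w
      = c • ZSpan.fundamentalDomain w := rfl
  rw [e, Measure.addHaar_smul, finrank_euclideanSpace, Fintype.card_fin,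
    abs_of_pos (pow_pos hc n), ENNReal.mul_inv]
  · exact Or.inr (volume_fundamentalDomain_ne_top w)
  · exact Or.inl ENNReal.ofReal_ne_top

/-- Dilating `w` by `c` contracts the dual lattice by `c`; multiplying by `c` maps that lattice back
and takes `K` into `L`. -/
theorem Admissible.smul {n : ℕ} {K L : Set (E n)} {w w' : Fin n → E n} {c : ℝ} (hc : 0 < c)
    (hKL : ∀ s ∈ K, c • s ∈ L) (hw' : ∀ i, w' i = c • w i) (h : Admissible L w) :
    Admissible K w' := by
  intro l hl hint hmem
  refine h (c • l) (smul_ne_zero hc.ne' hl) (fun i => ?_) ?_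
  · obtain ⟨j, hj⟩ := hint i
    refine ⟨j, ?_⟩
    rw [← hj, hw', inner_smul_left, inner_smul_right]
    simp
  · have h1 : c • interior K ⊆ interior L := by
      apply interior_maximal
      · rintro _ ⟨s, hs, rfl⟩
        exact hKL s (interior_subset hs)
      · exact isOpen_interior.smul₀ hc.ne'
    rw [smul_comm]
    exact h1 (Set.smul_mem_smul_set hmem)

theorem minSamplingDensity_le {n : ℕ} {K : Set (E n)} {w : Module.Basis (Fin n) ℝ (E n)}
    (h : GeneratesSamplingLattice K w) :
    minSamplingDensity K ≤ samplingDensity (latticePoints w) :=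
  iInf₂_le w h

/-- A sampling lattice for `L`, dilated by `c`, samples `K`, and its density drops by the factor
c^n. -/
theorem mul_minSamplingDensity_le {n : ℕ} {K L : Set (E n)} (hbdd : Bornology.IsBounded K)
    (hconv : Convex ℝ K) (hsymm : ∀ x ∈ K, -x ∈ K) (hsymm' : ∀ x ∈ L, -x ∈ L) {c : ℝ} (hc : 0 < c)
    (hKL : ∀ s ∈ K, c • s ∈ L) :
    ENNReal.ofReal (c ^ n) * minSamplingDensity K ≤ minSamplingDensity L := by
  refine le_iInf₂ fun w hw => ?_
  obtain ⟨w', hw', hd⟩ := exists_scaled_basis w hc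
  have hadm : Admissible K w' := (admissible_of_determines hsymm' hw).smul hc hKL hw'
  have := minSamplingDensity_le (w := w') (determines_of_admissible hbdd hconv hsymm hadm)
  rw [hd] at this
  refine (mul_le_mul' le_rfl this).trans ?_
  rw [← mul_assoc, ENNReal.mul_inv_cancel, one_mul]
  · exact (ENNReal.ofReal_pos.2 (pow_pos hc n)).ne'
  · exact ENNReal.ofReal_ne_top

/-- Every lattice samples a null set, so a fixed one can be dilated without bound; `1 ≤ n` makes c^n
tend to infinity. -/
theorem minSamplingDensity_eq_zero {n : ℕ} (hn : 1 ≤ n) {K : Set (E n)}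
    (hbdd : Bornology.IsBounded K) (h0 : volume K = 0) : minSamplingDensity K = 0 := by
  obtain ⟨w⟩ : Nonempty (Module.Basis (Fin n) ℝ (E n)) := ⟨(EuclideanSpace.basisFun (Fin n) ℝ).toBasis⟩
  have hfin : samplingDensity (latticePoints w) ≠ ∞ := by
    rw [samplingDensity_latticePoints]
    exact ENNReal.inv_ne_top.2 (ZSpan.measure_fundamentalDomain_ne_zero w)
  have hlim : Tendsto (fun c : ℝ => (ENNReal.ofReal (c ^ n))⁻¹ * samplingDensity (latticePoints w))
      atTop (𝓝 0) := by
    have h1 : Tendsto (fun c : ℝ => (ENNReal.ofReal (c ^ n))⁻¹) atTop (𝓝 0) := by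
      rw [← ENNReal.inv_top]
      exact (ENNReal.tendsto_ofReal_atTop.comp (tendsto_pow_atTop (by omega))).inv
    simpa using ENNReal.Tendsto.mul_const h1 (Or.inr hfin)
  refine le_antisymm (ge_of_tendsto hlim ?_) zero_le
  filter_upwards [eventually_gt_atTop 0] with c hc
  obtain ⟨w', -, hd⟩ := exists_scaled_basis w hc
  rw [← hd]
  exact minSamplingDensity_le (determines_of_volume_eq_zero hbdd h0 _)

theorem exists_generatesSamplingLattice {n : ℕ} {K : Set (E n)} (hbdd : Bornology.IsBounded K)
    (hconv : Convex ℝ K) (hsymm : ∀ x ∈ K, -x ∈ K) :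
    ∃ w : Module.Basis (Fin n) ℝ (E n), GeneratesSamplingLattice K w := by
  obtain ⟨R, hR0, hR⟩ := hbdd.exists_pos_norm_le
  -- A cubic lattice of spacing 1/R: a nonzero coordinate of a scaled dual point is at least 2πR,
  -- beyond the allowed 2R.
  obtain ⟨w, hw, -⟩ := exists_scaled_basis (EuclideanSpace.basisFun (Fin n) ℝ).toBasis
    (one_div_pos.2 hR0)
  refine ⟨w, determines_of_admissible hbdd hconv hsymm fun l hl hint hmem => hl ?_⟩
  have hnorm : ‖l‖ ≤ 2 * R := by
    have := hR _ (interior_subset hmem)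
    rw [norm_smul] at this
    norm_num at this
    linarith
  ext i
  obtain ⟨j, hj⟩ := hint i
  have hli : l i = 2 * Real.pi * j * R := by
    rw [hw, inner_smul_right] at hj
    have e : inner ℝ l ((EuclideanSpace.basisFun (Fin n) ℝ).toBasis i) = l i := by
      simp [EuclideanSpace.inner_single_right]
    rw [e] at hj
    rw [← hj]
    field_simp
  have hle : |l i| ≤ 2 * R := (PiLp.norm_apply_le l i).trans hnorm
  by_contra hne
  have hj0 : j ≠ 0 := by
    rintro rfl
    simp [hli] at hne
  have h1 : (1 : ℝ) ≤ |(j : ℝ)| := by exact_mod_cast Int.one_le_abs hj0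
  rw [hli, abs_mul, abs_mul, abs_of_pos hR0, abs_of_pos (by positivity : 0 < 2 * Real.pi)] at hle
  have h3 : 2 * Real.pi * R ≤ 2 * Real.pi * |(j : ℝ)| * R := by
    have : 0 < 2 * Real.pi * R := by positivity
    nlinarith
  nlinarith [Real.pi_gt_three]

theorem exists_tendsto_minSamplingDensity {n : ℕ} {K : Set (E n)} (hbdd : Bornology.IsBounded K)
    (hconv : Convex ℝ K) (hsymm : ∀ x ∈ K, -x ∈ K) :
    ∃ w : ℝ → Module.Basis (Fin n) ℝ (E n), (∀ ε, 0 < ε → GeneratesSamplingLattice K (w ε)) ∧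
      Tendsto (fun ε => samplingDensity (latticePoints (w ε))) (𝓝[>] 0)
        (𝓝 (minSamplingDensity K)) := by
  obtain ⟨w₀, hw₀⟩ := exists_generatesSamplingLattice hbdd hconv hsymm
  have hfin : minSamplingDensity K ≠ ∞ := by
    refine ne_top_of_le_ne_top ?_ (minSamplingDensity_le hw₀)
    rw [samplingDensity_latticePoints]
    exact ENNReal.inv_ne_top.2 (ZSpan.measure_fundamentalDomain_ne_zero w₀)
  have hex : ∀ ε : ℝ, ∃ w : Module.Basis (Fin n) ℝ (E n), 0 < ε → GeneratesSamplingLattice K w ∧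
      samplingDensity (latticePoints w) ≤ minSamplingDensity K + ENNReal.ofReal ε := by
    intro ε
    by_cases hε : 0 < ε
    · have hlt : minSamplingDensity K < minSamplingDensity K + ENNReal.ofReal ε :=
        ENNReal.lt_add_right hfin (ENNReal.ofReal_pos.2 hε).ne'
      conv_lhs at hlt => rw [minSamplingDensity]
      simp only [iInf_lt_iff] at hlt
      obtain ⟨w, hw, h⟩ := hlt
      exact ⟨w, fun _ => ⟨hw, h.le⟩⟩
    · exact ⟨w₀, fun h => absurd h hε⟩
  choose w hw using hex
  refine ⟨w, fun ε hε => (hw ε hε).1, ?_⟩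
  have hlim : Tendsto (fun ε : ℝ => minSamplingDensity K + ENNReal.ofReal ε) (𝓝[>] 0)
      (𝓝 (minSamplingDensity K)) := by
    have h1 : Tendsto (fun ε : ℝ => ENNReal.ofReal ε) (𝓝[>] 0) (𝓝 0) := by
      have := (ENNReal.continuous_ofReal.tendsto 0).mono_left
        (nhdsWithin_le_nhds (s := Set.Ioi (0 : ℝ)))
      simpa using this
    simpa using h1.const_add (minSamplingDensity K)
  refine tendsto_of_tendsto_of_tendsto_of_le_of_le' tendsto_const_nhds hlim ?_ ?_
  · filter_upwards [self_mem_nhdsWithin] with ε hε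
    exact minSamplingDensity_le (hw ε hε).1
  · filter_upwards [self_mem_nhdsWithin] with ε hε
    exact (hw ε hε).2

theorem mem_nyquistUniformSets {n : ℕ} {Ω : Set (E (n + 1))} (hbdd : Bornology.IsBounded Ω)
    (hconv : Convex ℝ Ω) (hsymm : ∀ x ∈ Ω, -x ∈ Ω) {U : E (n + 1) ≃ₗᵢ[ℝ] E (n + 1)}
    {w : Module.Basis (Fin n) ℝ (E n)} (h : GeneratesSamplingLattice (slice Ω U) w) :
    rotatedLineSet U w ∈ nyquistUniformSets Ω :=
  ⟨isUniformSet_rotatedLineSet U w, isTrajectorySet_rotatedLineSet U w,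
    nyquistCondition_of_admissible hbdd hconv hsymm U w
      (admissible_of_determines (neg_mem_slice hsymm U) h),
    nonDegenerate_rotatedLineSet U w⟩

theorem pathDensity_eq_samplingDensity {n : ℕ} (U : E (n + 1) ≃ₗᵢ[ℝ] E (n + 1))
    (w : Module.Basis (Fin n) ℝ (E n)) :
    pathDensity (rotatedLineSet U w) = samplingDensity (latticePoints w) := by
  rw [pathDensity_rotatedLineSet, samplingDensity_latticePoints]

theorem zero_mem_interior {k : ℕ} {K : Set (E k)} (hconv : Convex ℝ K) (hsymm : ∀ x ∈ K, -x ∈ K)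
    (h : (interior K).Nonempty) : (0 : E k) ∈ interior K := by
  obtain ⟨x, hx⟩ := h
  have := hconv.interior hx (neg_mem_interior hsymm hx) (a := 1 / 2) (b := 1 / 2)
    (by norm_num) (by norm_num) (by norm_num)
  simpa using this

/-! ### Flat sets and existence of an optimal rotation. -/

/-- A flat `Ω` has a rotation whose slice is a null set. -/
theorem exists_volume_slice_eq_zero {n : ℕ} (hn : 1 ≤ n) {Ω : Set (E (n + 1))}
    (hconv : Convex ℝ Ω) (hsymm : ∀ x ∈ Ω, -x ∈ Ω) (h : interior Ω = ∅) :
    ∃ V : E (n + 1) ≃ₗᵢ[ℝ] E (n + 1), volume (slice Ω V) = 0 := by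
  -- A nonempty symmetric convex set contains 0, so its affine and linear spans agree; a full affine
  -- span would give an interior.
  have hspan : Submodule.span ℝ Ω ≠ ⊤ := by
    intro htop
    rcases Ω.eq_empty_or_nonempty with rfl | ⟨x, hx⟩
    · rw [Submodule.span_empty] at htop
      exact bot_ne_top htop
    · have h0 : (0 : E (n + 1)) ∈ Ω := by
        have := hconv hx (hsymm x hx) (a := 1 / 2) (b := 1 / 2)
          (by norm_num) (by norm_num) (by norm_num)
        simpa using this
      have haff : affineSpan ℝ Ω = ⊤ := by
        apply SetLike.coe_injective
        rw [← Set.insert_eq_of_mem h0, affineSpan_insert_zero, htop]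
        rfl
      have := hconv.interior_nonempty_iff_affineSpan_eq_top.2 haff
      rw [h] at this
      exact Set.not_nonempty_empty this
  have horth : (Submodule.span ℝ Ω)ᗮ ≠ ⊥ := by
    rwa [Ne, Submodule.orthogonal_eq_bot_iff]
  obtain ⟨u, hu, hu0⟩ := Submodule.exists_mem_ne_zero_of_ne_bot horth
  obtain ⟨k, rfl⟩ : ∃ k, n = k + 1 := ⟨n - 1, by omega⟩
  -- The normal of `Ω` is turned into the first axis, which lies in the slice hyperplane since `1 ≤
  -- n`; the slice then falls into a proper subspace.
  set e : E (k + 1 + 1) := EuclideanSpace.single 0 ‖u‖ with he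
  have hnorm : ‖u‖ = ‖e‖ := by
    rw [he, PiLp.norm_single, norm_norm]
  refine ⟨(ℝ ∙ (u - e))ᗮ.reflection, ?_⟩
  set V : E (k + 1 + 1) ≃ₗᵢ[ℝ] E (k + 1 + 1) := (ℝ ∙ (u - e))ᗮ.reflection with hV
  have hVu : V u = e := Submodule.reflection_sub hnorm
  let T : E (k + 1) →ₗ[ℝ] ℝ := innerₗ (E (k + 1)) (EuclideanSpace.single 0 1)
  have hsub : slice Ω V ⊆ LinearMap.ker T := by
    intro s hs
    have h1 : inner ℝ u (V.symm (appendZero s)) = 0 :=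
      (Submodule.mem_orthogonal' _ _).1 hu _ (Submodule.subset_span hs)
    rw [← V.inner_map_map, hVu, LinearIsometryEquiv.apply_symm_apply, he,
      EuclideanSpace.inner_single_left] at h1
    have h2 : (appendZero s) 0 = s 0 := by
      change Fin.snoc (α := fun _ => ℝ) s.ofLp 0 (Fin.castSucc 0) = _
      rw [Fin.snoc_castSucc]
    rw [h2] at h1
    have h3 : s 0 = 0 := by
      rcases mul_eq_zero.1 h1 with h | h
      · simp [hu0] at h
      · exact h
    change inner ℝ (EuclideanSpace.single 0 1) s = 0
    rw [EuclideanSpace.inner_single_left, h3, mul_zero]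
  refine measure_mono_null hsub (Measure.addHaar_submodule volume _ ?_)
  intro htop
  have : EuclideanSpace.single (0 : Fin (k + 1)) (1 : ℝ) ∈ LinearMap.ker T := by
    rw [htop]; trivial
  have h1 : inner ℝ (EuclideanSpace.single (0 : Fin (k + 1)) (1 : ℝ))
    (EuclideanSpace.single (0 : Fin (k + 1)) (1 : ℝ)) = 0 := this
  simp at h1

/-- If `Ω` has an interior then slices depend continuously on the rotation. -/
theorem smul_mem_slice_of_norm_sub_le {n : ℕ} {Ω : Set (E (n + 1))} (hconv : Convex ℝ Ω) {r R : ℝ}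
    (hr : Metric.closedBall 0 r ⊆ Ω) (hR : ∀ x ∈ Ω, ‖x‖ ≤ R) {U V : E (n + 1) ≃ₗᵢ[ℝ] E (n + 1)}
    {c ε : ℝ} (hc0 : 0 < c) (hc1 : c < 1) (hUV : ∀ x, ‖V.symm x - U.symm x‖ ≤ ε * ‖x‖)
    (hε : c * (ε * R) ≤ (1 - c) * r) (hε0 : 0 ≤ ε) {s : E n} (hs : s ∈ slice Ω U) :
    c • s ∈ slice Ω V := by
  rw [mem_slice_iff] at hs ⊢
  have hsR : ‖s‖ ≤ R := by
    rw [← norm_place_zero_right U]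
    exact hR _ hs
  set v := place V (s, 0) - place U (s, 0) with hv
  have hvn : ‖v‖ ≤ ε * R := by
    have h1 := hUV (appendZero s)
    have h2 : ‖appendZero s‖ = ‖s‖ := by
      rw [← norm_place_zero_right U, place_zero_right, LinearIsometryEquiv.norm_map]
    rw [h2] at h1
    exact h1.trans (mul_le_mul_of_nonneg_left hsR hε0)
  have h1c : 0 < 1 - c := by linarith
  -- The target `c • place V (s, 0)` is the convex combination of `place U (s, 0)`, with weight `c`,
  -- and this point, with weight `1 - c`.
  have hmem : (c / (1 - c)) • v ∈ Ω := by
    apply hr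
    rw [mem_closedBall_zero_iff, norm_smul, Real.norm_of_nonneg (by positivity), div_mul_eq_mul_div,
      div_le_iff₀ h1c, mul_comm r]
    exact (mul_le_mul_of_nonneg_left hvn hc0.le).trans hε
  have := hconv hs hmem hc0.le h1c.le (by ring)
  rw [smul_smul, mul_div_cancel₀ _ h1c.ne', ← smul_add, hv, add_sub_cancel, ← map_smul] at this
  simpa using this

/-- A lower semicontinuous function on a compact set attains its minimum. A flat `Ω` is treated
apart, since there a small rotation may change the slice abruptly. -/
theorem exists_isOptimalRotation {n : ℕ} (hn : 1 ≤ n) {Ω : Set (E (n + 1))}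
    (hbdd : Bornology.IsBounded Ω) (hconv : Convex ℝ Ω) (hsymm : ∀ x ∈ Ω, -x ∈ Ω) :
    ∃ U : E (n + 1) ≃ₗᵢ[ℝ] E (n + 1), IsOptimalRotation Ω U := by
  rcases (interior Ω).eq_empty_or_nonempty with hempty | hne
  · obtain ⟨V, hV⟩ := exists_volume_slice_eq_zero hn hconv hsymm hempty
    refine ⟨V, fun W => ?_⟩
    rw [minSamplingDensity_eq_zero hn (isBounded_slice hbdd V) hV]
    exact zero_le
  have h0 := zero_mem_interior hconv hsymm hne
  obtain ⟨r, hr0, hr⟩ := Metric.nhds_basis_closedBall.mem_iff.1 (mem_interior_iff_mem_nhds.1 h0)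
  obtain ⟨R, hR0, hR⟩ := hbdd.exists_pos_norm_le
  -- Operators `A` in `S` stand for the inverses `U⁻¹`.
  set S : Set (E (n + 1) →L[ℝ] E (n + 1)) := {A | ∀ x, ‖A x‖ = ‖x‖} with hS
  have hScpt : IsCompact S := by
    have : ProperSpace (E (n + 1) →L[ℝ] E (n + 1)) := FiniteDimensional.proper ℝ _
    refine Metric.isCompact_of_isClosed_isBounded ?_ ?_
    · rw [hS, Set.ofPred_forall]
      exact isClosed_iInter fun x => isClosed_eq (by fun_prop) continuous_const
    · refine isBounded_iff_forall_norm_le.2 ⟨1, fun A hA => ?_⟩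
      exact A.opNorm_le_bound zero_le_one fun x => by rw [hA x, one_mul]
  have hex : ∀ A ∈ S, ∃ U : E (n + 1) ≃ₗᵢ[ℝ] E (n + 1), ∀ x, U.symm x = A x := by
    intro A hA
    let A' : E (n + 1) →ₗᵢ[ℝ] E (n + 1) := ⟨A.toLinearMap, hA⟩
    exact ⟨(A'.toLinearIsometryEquiv rfl).symm, fun x => rfl⟩
  set ρ : (E (n + 1) →L[ℝ] E (n + 1)) → ℝ≥0∞ :=
    fun A => minSamplingDensity {s : E n | A (appendZero s) ∈ Ω} with hρ
  have hρU : ∀ A (U : E (n + 1) ≃ₗᵢ[ℝ] E (n + 1)), (∀ x, U.symm x = A x) →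
      ρ A = minSamplingDensity (slice Ω U) := by
    intro A U h
    simp only [hρ, slice, h]
  have hlsc : LowerSemicontinuousOn ρ S := by
    intro A hA y hy
    obtain ⟨U, hU⟩ := hex A hA
    have hlim : Tendsto (fun c : ℝ => ENNReal.ofReal (c ^ n) * ρ A) (𝓝[<] 1) (𝓝 (ρ A)) := by
      have h1 : Tendsto (fun c : ℝ => ENNReal.ofReal (c ^ n)) (𝓝[<] 1) (𝓝 1) := by
        have : Continuous fun c : ℝ => ENNReal.ofReal (c ^ n) :=
          ENNReal.continuous_ofReal.comp (continuous_pow n)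
        have := (this.tendsto 1).mono_left (nhdsWithin_le_nhds (s := Set.Iio (1 : ℝ)))
        simpa using this
      simpa using ENNReal.Tendsto.mul_const h1 (Or.inl one_ne_zero) (b := ρ A)
    obtain ⟨c, ⟨hyc, hc1⟩, hc0⟩ := (((hlim.eventually (lt_mem_nhds hy)).and
      self_mem_nhdsWithin).and (mem_nhdsWithin_of_mem_nhds (lt_mem_nhds one_pos))).exists
    have hc1 : c < 1 := hc1
    have hc0 : 0 < c := hc0
    -- Chosen so that `c * (ε * R) = (1 - c) * r`, the tolerance under which slices contract into
    -- each other by the factor `c`.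
    set ε := (1 - c) * r / (c * R) with hε
    have hε0 : 0 < ε := div_pos (mul_pos (by linarith) hr0) (by positivity)
    filter_upwards [self_mem_nhdsWithin,
      mem_nhdsWithin_of_mem_nhds (Metric.ball_mem_nhds A hε0)] with B hB hBA
    obtain ⟨V, hV⟩ := hex B hB
    refine hyc.trans_le ?_
    rw [hρU A U hU, hρU B V hV]
    refine mul_minSamplingDensity_le (isBounded_slice hbdd U) (convex_slice hconv U)
      (neg_mem_slice hsymm U) (neg_mem_slice hsymm V) hc0 fun s hs => ?_
    refine smul_mem_slice_of_norm_sub_le hconv hr hR hc0 hc1 (ε := ε) (fun x => ?_) ?_ hε0.le hs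
    · rw [hU, hV, ← sub_apply]
      refine (B - A).le_of_opNorm_le ?_ x
      rw [mem_ball_iff_norm] at hBA
      exact hBA.le
    · rw [hε]
      field_simp
      exact le_rfl
  have hSne : S.Nonempty := ⟨ContinuousLinearMap.id ℝ _, fun x => rfl⟩
  obtain ⟨A, hA, hmin⟩ := hlsc.exists_isMinOn hSne hScpt
  obtain ⟨U, hU⟩ := hex A hA
  refine ⟨U, fun V => ?_⟩
  rw [← hρU A U hU, ← hρU (V.symm.toContinuousLinearEquiv : E (n + 1) →L[ℝ] E (n + 1)) V
    fun x => rfl]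
  exact hmin fun x => V.symm.norm_map x

/-! ### Optimality among uniform sets. -/

/-- `Q` consists of the lines over some lattice for some rotation `V`; with an interior, the Nyquist
condition makes that lattice a sampling lattice for the slice of `V`, which is no better than the
optimal one. -/
theorem minSamplingDensity_slice_le_pathDensity {n : ℕ} (hn : 1 ≤ n) {Ω : Set (E (n + 1))}
    (hbdd : Bornology.IsBounded Ω) (hconv : Convex ℝ Ω) (hsymm : ∀ x ∈ Ω, -x ∈ Ω)
    {U : E (n + 1) ≃ₗᵢ[ℝ] E (n + 1)} (hU : IsOptimalRotation Ω U) {Q : Set (ℝ → E (n + 1))}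
    (hQ : Q ∈ nyquistUniformSets Ω) : minSamplingDensity (slice Ω U) ≤ pathDensity Q := by
  obtain ⟨hunif, -, hnyq, -⟩ := hQ
  obtain ⟨V, w, rfl⟩ := hunif.exists_eq_rotatedLineSet
  rcases (interior Ω).eq_empty_or_nonempty with hempty | hne
  · obtain ⟨V', hV'⟩ := exists_volume_slice_eq_zero hn hconv hsymm hempty
    refine (hU V').trans ?_
    rw [minSamplingDensity_eq_zero hn (isBounded_slice hbdd V') hV']
    exact zero_le
  · rw [pathDensity_eq_samplingDensity]
    refine (hU V).trans (minSamplingDensity_le ?_)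
    exact determines_of_admissible (isBounded_slice hbdd V) (convex_slice hconv V)
      (neg_mem_slice hsymm V)
      (admissible_slice_of_nyquist hconv hsymm (zero_mem_interior hconv hsymm hne) hnyq)

theorem iInf_pathDensity_eq {n : ℕ} (hn : 1 ≤ n) {Ω : Set (E (n + 1))}
    (hbdd : Bornology.IsBounded Ω) (hconv : Convex ℝ Ω) (hsymm : ∀ x ∈ Ω, -x ∈ Ω)
    {U : E (n + 1) ≃ₗᵢ[ℝ] E (n + 1)} (hU : IsOptimalRotation Ω U) :
    ⨅ Q ∈ nyquistUniformSets Ω, pathDensity Q = minSamplingDensity (slice Ω U) := by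
  apply le_antisymm
  · refine le_iInf₂ fun w hw => ?_
    rw [← pathDensity_eq_samplingDensity U w]
    exact iInf₂_le _ (mem_nyquistUniformSets hbdd hconv hsymm hw)
  · exact le_iInf₂ fun Q hQ =>
      minSamplingDensity_slice_le_pathDensity hn hbdd hconv hsymm hU hQ

end PathSampling

open PathSampling
theorem corollary1 (n : ℕ) (hn : 1 ≤ n) (Ω : Set (E (n + 1)))
    (hcompact : IsCompact Ω) (hconvex : Convex ℝ Ω) (hsymm : ∀ x ∈ Ω, -x ∈ Ω) :
    -- an optimal rotation exists
    (∃ U : E (n + 1) ≃ₗᵢ[ℝ] E (n + 1), IsOptimalRotation Ω U) ∧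
    ∀ U : E (n + 1) ≃ₗᵢ[ℝ] E (n + 1), IsOptimalRotation Ω U →
      -- optimal sampling lattices for the slice give optimal uniform sets
      (∀ w : Module.Basis (Fin n) ℝ (E n), GeneratesSamplingLattice (slice Ω U) w →
        samplingDensity (latticePoints w) = minSamplingDensity (slice Ω U) →
          rotatedLineSet U w ∈ nyquistUniformSets Ω ∧
          ∀ Q ∈ nyquistUniformSets Ω, pathDensity (rotatedLineSet U w) ≤ pathDensity Q) ∧
      -- families of sampling lattices for the slice that approach optimality exist
      (∃ w : ℝ → Module.Basis (Fin n) ℝ (E n),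
        (∀ ε, 0 < ε → GeneratesSamplingLattice (slice Ω U) (w ε)) ∧
        Tendsto (fun ε => samplingDensity (latticePoints (w ε))) (𝓝[>] 0)
          (𝓝 (minSamplingDensity (slice Ω U)))) ∧
      -- and each of them gives uniform sets that approach optimality
      (∀ w : ℝ → Module.Basis (Fin n) ℝ (E n),
        (∀ ε, 0 < ε → GeneratesSamplingLattice (slice Ω U) (w ε)) →
        Tendsto (fun ε => samplingDensity (latticePoints (w ε))) (𝓝[>] 0)
          (𝓝 (minSamplingDensity (slice Ω U))) →
          (∀ ε, 0 < ε → rotatedLineSet U (w ε) ∈ nyquistUniformSets Ω) ∧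
          Tendsto (fun ε => pathDensity (rotatedLineSet U (w ε))) (𝓝[>] 0)
            (𝓝 (⨅ Q ∈ nyquistUniformSets Ω, pathDensity Q))) := by
  have hbdd := hcompact.isBounded
  refine ⟨exists_isOptimalRotation hn hbdd hconvex hsymm, fun U hU => ⟨?_, ?_, ?_⟩⟩
  · intro w hw hopt
    refine ⟨mem_nyquistUniformSets hbdd hconvex hsymm hw, fun Q hQ => ?_⟩
    rw [pathDensity_eq_samplingDensity, hopt]
    exact minSamplingDensity_slice_le_pathDensity hn hbdd hconvex hsymm hU hQ
  · exact exists_tendsto_minSamplingDensity (isBounded_slice hbdd U) (convex_slice hconvex U)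
      (neg_mem_slice hsymm U)
  · intro w hw hlim
    refine ⟨fun ε hε => mem_nyquistUniformSets hbdd hconvex hsymm (hw ε hε), ?_⟩
    rw [iInf_pathDensity_eq hn hbdd hconvex hsymm hU]
    simpa only [pathDensity_eq_samplingDensity] using hlim
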